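/- Let $G$ be a compact group and let $\rho_1,\dots,\rho_{2n}$ be finite-dimensional continuous unitary representations of $G$ on Hilbert spaces with fixed orthonormal (computational) bases. Put $\mathcal I_i=V_{\rho_{2i-1}}$, $\mathcal O_i=V_{\rho_{2i}}$, $\mathcal I^n=\bigotimes_{i=1}^n\mathcal I_i$, $\mathcal O^n=\bigotimes_{i=1}^n\mathcal O_i$; let $\overline{\rho}$ denote the entrywise complex conjugate of $\rho$ in the computational basis. A quantum comb is given by its Choi matrix: an operator $C\succeq 0$ on $\mathcal I^n\otimes\mathcal O^n$ such that, with $C_n:=C$ and $C_{i-1}:=\frac1{\dim\mathcal I_i}\mathrm{Tr}_{\mathcal I_i\mathcal O_i}C_i$, one has $\mathrm{Tr}_{\mathcal O_i}C_i=C_{i-1}\otimes\mathbb 1_{\mathcal I_i}$ for $i=1,\dots,n$, and $C_0=1$. Its channel $\Psi$ is determined by $C=\sum_{\vec\imath,\vec\jmath}|\vec\imath\rangle\langle\vec\jmath|\otimes\Psi(|\vec\imath\rangle\langle\vec\jmath|)$. Circuits. For $0\le k\le 2n$ let $\hat G^{(k)}$ be the set of irreps of $G$ (up to isomorphism, one representative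 $V_\lambda$ fixed for each) that occur in $\bigotimes_{j\le k}\rho_j$; $\hat G^{(0)}$ consists of the trivial irrep. A CG transform of an irrep $\mu$ and a unitary representation $\rho$ is a unitary intertwiner $\mathrm{CG}_{\mu,\rho}:V_\mu\otimes V_\rho\to\bigoplus_\lambda V_\lambda\otimes\mathbb C^{c_{\mu\rho}^\lambda}$, where $c_{\mu\rho}^\lambda$ is the multiplicity of $\lambda$ in $\mu\otimes\rho$ and $\lambda$ runs over the irreps that occur. Such transforms exist. Fix any choice of the generalized CG transforms $\mathrm{CG}_{\mu,\rho_{2i-1}}$ ($\mu\in\hat G^{(2i-2)}$) and of the dual CG transforms $\mathrm{CG}_{\nu,\overline{\rho}_{2i}}$ ($\nu\in\hat G^{(2i)}$), $i=1,\dots,n$. Given finite-dimensional memory spaces $\mathcal M_0=\mathbb C,\mathcal M_1,\dots,\mathcal M_n$, put $\mathcal A_i=\mathcal M_i\otimes\bigoplus_{\lambda\in\hat G^{(2i)}}V_\lambda$ (so $\mathcal A_0\cong\mathbb C$). Given isometries $$V_i^{\lambda}:\ \mathcal M_{i-1}\otimes\bigoplus_{\mu\in\hat G^{(2i-2)}}\mathbb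 C^{c_{\mu\rho_{2i-1}}^{\lambda}}\ \to\ \mathcal M_i\otimes\bigoplus_{\nu\in\hat G^{(2i)}}\mathbb C^{c_{\nu\overline{\rho}_{2i}}^{\lambda}},\qquad \lambda\in\hat G^{(2i-1)},\ 1\le i\le n$$ (where $c_{\nu\overline{\rho}_{2i}}^{\lambda}=c_{\lambda\rho_{2i}}^{\nu}$), acting on the memory, irrep-label and multiplicity registers, let $W_i:\mathcal A_{i-1}\otimes\mathcal I_i\to\mathcal A_i\otimes\mathcal O_i$ be the composition of $\mathbb 1_{\mathcal M_{i-1}}\otimes\bigoplus_{\mu}\mathrm{CG}_{\mu,\rho_{2i-1}}$, of the operators $V_i^{\lambda}$ controlled on the label $\lambda\in\hat G^{(2i-1)}$ (and acting trivially on $V_\lambda$), and of the inverse dual CG transform $\mathbb 1_{\mathcal M_i}\otimes\bigoplus_\nu\mathrm{CG}_{\nu,\overline{\rho}_{2i}}^\dagger$. We say that $C$ is realized by the circuit for $(\rho_k)$ if, for every choice of the CG transforms, there are memory spaces and isometries $V_i^\lambda$ as above such that all $W_i$ are isometries and the sequential circuit $W_n\cdots W_1$ followed by the partial trace over $\mathcal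 A_n$ has Choi matrix $C$. Theorem. Let $C$ be the Choi matrix of a quantum comb, with channel $\Psi$. (a) If $\big[C,\ (\bigotimes_{i}\rho_{2i-1}(g))_{\mathcal I^n}\otimes(\bigotimes_i\rho_{2i}(g))_{\mathcal O^n}\big]=0$ for all $g\in G$, then $C$ is realized by the circuit for the conjugate representations $(\overline{\rho}_k)$. (b) If $\Psi\big(\rho(g)X\rho(g)^\dagger\big)=\overline{\sigma}(g)\,\Psi(X)\,\overline{\sigma}(g)^\dagger$ for all $g\in G$ and all $X$, where $\rho=\bigotimes_i\rho_{2i-1}$ and $\sigma=\bigotimes_i\rho_{2i}$, then $C$ is realized by the circuit for $(\rho_k)$. -/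

import Mathlib

open scoped Kronecker ComplexOrder

namespace QComb

/-! ### Finite-dimensional unitary representations in a fixed orthonormal basis -/

/-- A unitary representation of `G` on the Hilbert space `ℂ^ι` with its computational basis. -/
abbrev URep (G : Type*) [Group G] (ι : Type*) [Fintype ι] [DecidableEq ι] :=
  G →* Matrix.unitaryGroup ι ℂ

section Reps

variable {G : Type*} [Group G] {ι κ : Type*} [Fintype ι] [DecidableEq ι] [Fintype κ]
  [DecidableEq κ]

/-- The unitary matrix `σ(g)`. -/
def URep.mat (σ : URep G ι) (g : G) : Matrix ι ι ℂ := (σ g).1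

theorem URep.mat_one (σ : URep G ι) : σ.mat 1 = 1 := by
  unfold URep.mat
  rw [map_one]
  rfl

theorem URep.mat_mul (σ : URep G ι) (g h : G) : σ.mat (g * h) = σ.mat g * σ.mat h := by
  unfold URep.mat
  rw [map_mul]
  rfl

theorem URep.mat_inv (σ : URep G ι) (g : G) : σ.mat g⁻¹ = (σ.mat g).conjTranspose := by
  unfold URep.mat
  rw [map_inv]
  rfl

/-- The underlying linear representation. -/
noncomputable def URep.toRep (σ : URep G ι) : Representation ℂ G (ι → ℂ) :=
  (Matrix.toLinAlgEquiv' (R := ℂ) (n := ι)).toAlgHom.toMonoidHom.comp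
    ((Submonoid.subtype (Matrix.unitaryGroup ι ℂ)).comp σ)

theorem URep.toRep_apply (σ : URep G ι) (g : G) (v : ι → ℂ) :
    σ.toRep g v = (σ.mat g).mulVec v := rfl

/-- The tensor product `g ↦ σ g ⊗ τ g`. -/
def URep.tensor (σ : URep G ι) (τ : URep G κ) : URep G (ι × κ) where
  toFun g := ⟨σ.mat g ⊗ₖ τ.mat g, Matrix.kronecker_mem_unitary (σ g).2 (τ g).2⟩
  map_one' := Subtype.ext (by
    change σ.mat 1 ⊗ₖ τ.mat 1 = 1
    rw [URep.mat_one, URep.mat_one, Matrix.one_kronecker_one])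
  map_mul' g h := Subtype.ext (by
    change σ.mat (g * h) ⊗ₖ τ.mat (g * h) = (σ.mat g ⊗ₖ τ.mat g) * (σ.mat h ⊗ₖ τ.mat h)
    rw [URep.mat_mul, URep.mat_mul, Matrix.mul_kronecker_mul])

/-- The complex conjugate representation, entrywise in the computational basis. -/
def URep.conj (σ : URep G ι) : URep G ι where
  toFun g := ⟨(σ.mat g).map (starRingEnd ℂ), by
    rw [Matrix.mem_unitaryGroup_iff]
    have h : σ.mat g * (σ.mat g).conjTranspose = 1 := Matrix.mem_unitaryGroup_iff.1 (σ g).2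
    have h2 := congrArg (fun A : Matrix ι ι ℂ => A.map (starRingEnd ℂ)) h
    simp only [Matrix.map_mul] at h2
    rw [Matrix.map_one _ (map_zero _) (map_one _)] at h2
    exact h2⟩
  map_one' := Subtype.ext (by
    change (σ.mat 1).map (starRingEnd ℂ) = 1
    rw [URep.mat_one, Matrix.map_one _ (map_zero _) (map_one _)])
  map_mul' g h := Subtype.ext (by
    change (σ.mat (g * h)).map (starRingEnd ℂ)
      = (σ.mat g).map (starRingEnd ℂ) * (σ.mat h).map (starRingEnd ℂ)
    rw [URep.mat_mul, Matrix.map_mul])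

/-- The one-dimensional trivial representation. -/
def URep.triv (G : Type*) [Group G] : URep G Unit := 1

theorem intertwiner_mat (τ : URep G κ) (σ : URep G ι)
    (f : Representation.IntertwiningMap τ.toRep σ.toRep) :
    ∃ A : Matrix ι κ ℂ, (∀ v, f v = A.mulVec v) ∧ ∀ g, A * τ.mat g = σ.mat g * A := by
  have hA : ∀ v, f v = (LinearMap.toMatrix' f.toLinearMap).mulVec v := fun v => by
    rw [LinearMap.toMatrix'_mulVec]; rfl
  refine ⟨LinearMap.toMatrix' f.toLinearMap, hA, fun g => ?_⟩
  apply Matrix.ext_of_mulVec_single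
  intro i
  rw [← Matrix.mulVec_mulVec, ← Matrix.mulVec_mulVec, ← hA, ← hA]
  exact LinearMap.congr_fun (f.isIntertwining' g) _

end Reps

/-! ### Irreducible representations -/

/-- A continuous irreducible unitary representation of `G` on some `ℂ^d`. -/
structure UnitaryIrrep (G : Type*) [Group G] [TopologicalSpace G] where
  dim : ℕ
  rep : URep G (Fin dim)
  cont : Continuous fun g => rep.mat g
  irred : rep.toRep.IsIrreducible

/-- Two irreducible representations are identified when they are isomorphic. -/
instance UnitaryIrrep.setoid (G : Type*) [Group G] [TopologicalSpace G] :
    Setoid (UnitaryIrrep G) where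
  r a b := Nonempty (a.rep.toRep.Equiv b.rep.toRep)
  iseqv :=
    { refl := fun _ => ⟨Representation.Equiv.refl _⟩
      symm := fun ⟨e⟩ => ⟨e.symm⟩
      trans := fun ⟨e⟩ ⟨f⟩ => ⟨e.trans f⟩ }

/-- The set of irreps of `G`, up to isomorphism. -/
def Irr (G : Type*) [Group G] [TopologicalSpace G] : Type _ :=
  Quotient (UnitaryIrrep.setoid G)

section Irreps

variable {G : Type*} [Group G] [TopologicalSpace G] {ι : Type*} [Fintype ι] [DecidableEq ι]

/-- `d_λ = dim V_λ`. -/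
noncomputable def Irr.dim (l : Irr G) : ℕ := (Quotient.out l).dim

/-- A representative of the class `λ`, acting on `V_λ = ℂ^{d_λ}`. -/
noncomputable def Irr.rep (l : Irr G) : URep G (Fin l.dim) := (Quotient.out l).rep

/-- The multiplicity of the irrep `λ` in `σ`, that is, `dim Hom_G(V_λ, V_σ)`. -/
noncomputable def mult (l : Irr G) (σ : URep G ι) : ℕ :=
  Module.finrank ℂ (Representation.IntertwiningMap l.rep.toRep σ.toRep)

/-- The irreps that appear in the decomposition of `σ`. -/
def Constituent (σ : URep G ι) : Type _ := {l : Irr G // 0 < mult l σ}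

theorem orthogonal_of_ne (σ : URep G ι) {l l' : Irr G} (hne : l ≠ l')
    (f : Representation.IntertwiningMap l.rep.toRep σ.toRep)
    (f' : Representation.IntertwiningMap l'.rep.toRep σ.toRep)
    (u : Fin l.dim → ℂ) (u' : Fin l'.dim → ℂ) : star (f u) ⬝ᵥ (f' u') = 0 := by
  obtain ⟨A, hA, hi⟩ := intertwiner_mat _ _ f
  obtain ⟨A', hA', hi'⟩ := intertwiner_mat _ _ f'
  have hB : ∀ g, (A.conjTranspose * A') * l'.rep.mat g
      = l.rep.mat g * (A.conjTranspose * A') := fun g => by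
    have e1 := congrArg Matrix.conjTranspose (hi g⁻¹)
    rw [Matrix.conjTranspose_mul, Matrix.conjTranspose_mul, URep.mat_inv, URep.mat_inv,
      Matrix.conjTranspose_conjTranspose, Matrix.conjTranspose_conjTranspose] at e1
    rw [Matrix.mul_assoc, hi' g, ← Matrix.mul_assoc, ← e1, Matrix.mul_assoc]
  let F : Representation.IntertwiningMap l'.rep.toRep l.rep.toRep :=
    { Matrix.mulVecLin (A.conjTranspose * A') with
      isIntertwining' := fun g => by
        apply LinearMap.ext
        intro x
        change (A.conjTranspose * A').mulVec ((l'.rep.mat g).mulVec x)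
          = (l.rep.mat g).mulVec ((A.conjTranspose * A').mulVec x)
        rw [Matrix.mulVec_mulVec, Matrix.mulVec_mulVec, hB g] }
  have i1 : l.rep.toRep.IsIrreducible := (Quotient.out l).irred
  have i2 : l'.rep.toRep.IsIrreducible := (Quotient.out l').irred
  have i3 : IsEmpty (Representation.Equiv l'.rep.toRep l.rep.toRep) := ⟨fun e => hne (by
    rw [← Quotient.out_eq l, ← Quotient.out_eq l']
    exact (Quotient.sound (show Nonempty _ from ⟨e⟩)).symm)⟩
  have h0 : F = 0 := Subsingleton.elim _ _
  have h1 : (A.conjTranspose * A').mulVec u' = 0 := by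
    change F u' = 0
    rw [h0]; rfl
  rw [hA, hA', Matrix.star_mulVec, ← Matrix.dotProduct_mulVec, Matrix.mulVec_mulVec, h1,
    dotProduct_zero]

instance Constituent.finite (σ : URep G ι) : Finite (Constituent σ) := by
  have hex : ∀ l : Constituent σ, ∃ v : EuclideanSpace ℂ ι, v ≠ 0 ∧
      ∃ (f : Representation.IntertwiningMap l.1.rep.toRep σ.toRep) (u : Fin l.1.dim → ℂ),
        v = WithLp.toLp 2 (f u) := fun l => by
    have := Module.nontrivial_of_finrank_pos l.2
    obtain ⟨f, hf⟩ := exists_ne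
      (0 : Representation.IntertwiningMap l.1.rep.toRep σ.toRep)
    have : ∃ u, f u ≠ 0 := by
      by_contra! h
      apply hf
      ext1
      exact LinearMap.ext h
    obtain ⟨u, hu⟩ := this
    exact ⟨WithLp.toLp 2 (f u), by simpa using hu, f, u, rfl⟩
  choose v hv0 f u hv using hex
  have hli : LinearIndependent ℂ v := by
    refine linearIndependent_of_ne_zero_of_inner_eq_zero hv0 fun l l' hne => ?_
    change inner ℂ (v l) (v l') = 0
    rw [hv l, hv l', EuclideanSpace.inner_toLp_toLp, dotProduct_comm]
    exact orthogonal_of_ne σ (fun h => hne (Subtype.ext h)) _ _ _ _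
  exact hli.finite

noncomputable instance Constituent.fintype (σ : URep G ι) : Fintype (Constituent σ) :=
  Fintype.ofFinite _

/-- A Clebsch–Gordan transform of `σ`: a unitary isomorphism
`V_σ → ⨁_λ V_λ ⊗ ℂ^{mult λ σ}` of representations, given by its blocks
`V_σ → V_λ ⊗ ℂ^{mult λ σ}`. The transform `CG_{μ,ρ}` is the case `σ = μ ⊗ ρ`. -/
structure CGTransform (σ : URep G ι) where
  block : ∀ l : Irr G, Matrix (Fin l.dim × Fin (mult l σ)) ι ℂ
  intertwines : ∀ (l : Irr G) (g : G),
    block l * σ.mat g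
      = (l.rep.mat g ⊗ₖ
          (1 : Matrix (Fin (mult l σ)) (Fin (mult l σ)) ℂ)) * block l
  orthonormal : ∀ l : Irr G, block l * (block l).conjTranspose = 1
  orthogonal : ∀ l l' : Irr G, l ≠ l' → block l * (block l').conjTranspose = 0
  complete : ∑ l : Constituent σ, (block l.1).conjTranspose * block l.1 = 1

end Irreps

/-! ### Quantum combs

The systems are `V_{ρ_0}, V_{ρ_1}, V_{ρ_2}, …` with `V_{ρ_k} = ℂ^{d k}`; the input of the `i`-th
step (`i = 0, 1, …`) is `V_{ρ_{2i}}` and its output is `V_{ρ_{2i+1}}`. An `n`-step comb only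
involves the systems with index less than `2n`. -/

/-- Computational basis of the first `n` inputs `⨂_{i<n} V_{ρ_{2i}}`. -/
@[reducible] def In (d : ℕ → ℕ) : ℕ → Type
  | 0 => Unit
  | n + 1 => In d n × Fin (d (2 * n))

/-- Computational basis of the first `n` outputs `⨂_{i<n} V_{ρ_{2i+1}}`. -/
@[reducible] def Out (d : ℕ → ℕ) : ℕ → Type
  | 0 => Unit
  | n + 1 => Out d n × Fin (d (2 * n + 1))

/-- Computational basis of the first `k` systems `⨂_{j<k} V_{ρ_j}`. -/
@[reducible] def Sys (d : ℕ → ℕ) : ℕ → Type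
  | 0 => Unit
  | k + 1 => Sys d k × Fin (d k)

section Instances

variable (d : ℕ → ℕ)

instance In.fintype : ∀ n, Fintype (In d n)
  | 0 => inferInstanceAs (Fintype Unit)
  | n + 1 => letI := In.fintype n; inferInstanceAs (Fintype (In d n × Fin (d (2 * n))))

instance In.decEq : ∀ n, DecidableEq (In d n)
  | 0 => inferInstanceAs (DecidableEq Unit)
  | n + 1 => letI := In.decEq n; inferInstanceAs (DecidableEq (In d n × Fin (d (2 * n))))

instance Out.fintype : ∀ n, Fintype (Out d n)
  | 0 => inferInstanceAs (Fintype Unit)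
  | n + 1 => letI := Out.fintype n; inferInstanceAs (Fintype (Out d n × Fin (d (2 * n + 1))))

instance Out.decEq : ∀ n, DecidableEq (Out d n)
  | 0 => inferInstanceAs (DecidableEq Unit)
  | n + 1 => letI := Out.decEq n; inferInstanceAs (DecidableEq (Out d n × Fin (d (2 * n + 1))))

instance Sys.fintype : ∀ n, Fintype (Sys d n)
  | 0 => inferInstanceAs (Fintype Unit)
  | n + 1 => letI := Sys.fintype n; inferInstanceAs (Fintype (Sys d n × Fin (d n)))

instance Sys.decEq : ∀ n, DecidableEq (Sys d n)
  | 0 => inferInstanceAs (DecidableEq Unit)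
  | n + 1 => letI := Sys.decEq n; inferInstanceAs (DecidableEq (Sys d n × Fin (d n)))

end Instances

/-- Operators on `𝓘^n ⊗ 𝓞^n`. -/
abbrev ChoiMat (d : ℕ → ℕ) (n : ℕ) := Matrix (In d n × Out d n) (In d n × Out d n) ℂ

/-- `C_{n} = (1 / dim 𝓘_{n+1}) Tr_{𝓘_{n+1} 𝓞_{n+1}} C_{n+1}`. -/
noncomputable def reduce {d : ℕ → ℕ} {n : ℕ} (C : ChoiMat d (n + 1)) : ChoiMat d n :=
  Matrix.of fun p q => (d (2 * n) : ℂ)⁻¹ *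
    ∑ a : Fin (d (2 * n)), ∑ b : Fin (d (2 * n + 1)),
      C ((p.1, a), (p.2, b)) ((q.1, a), (q.2, b))

/-- The linear comb conditions: `C_0 = 1` and `Tr_{𝓞_i} C_i = C_{i-1} ⊗ 1_{𝓘_i}` for all `i`. -/
def CombLinear {d : ℕ → ℕ} : ∀ n, ChoiMat d n → Prop
  | 0, C => C = 1
  | n + 1, C =>
    (∀ (x x' : In d n) (y y' : Out d n) (a a' : Fin (d (2 * n))),
      ∑ b : Fin (d (2 * n + 1)), C ((x, a), (y, b)) ((x', a'), (y', b))
        = if a = a' then reduce C (x, y) (x', y') else 0) ∧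
    CombLinear n (reduce C)

/-- `C` is the Choi matrix of a quantum comb with `n` steps. -/
def IsComb {d : ℕ → ℕ} (n : ℕ) (C : ChoiMat d n) : Prop :=
  C.PosSemidef ∧ CombLinear n C

/-- The quantum channel `Ψ` with Choi matrix `C = ∑ |i⟩⟨j| ⊗ Ψ(|i⟩⟨j|)`. -/
def channel {d : ℕ → ℕ} {n : ℕ} (C : ChoiMat d n) (X : Matrix (In d n) (In d n) ℂ) :
    Matrix (Out d n) (Out d n) ℂ :=
  Matrix.of fun y y' => ∑ i : In d n, ∑ j : In d n, X i j * C (i, y) (j, y')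

section Circuit

variable {G : Type*} [Group G] {d : ℕ → ℕ}

/-- The representation `⨂_{i<n} ρ_{2i}` on the inputs. -/
def inRep (ρ : ∀ k, URep G (Fin (d k))) : ∀ n, URep G (In d n)
  | 0 => URep.triv G
  | n + 1 => (inRep ρ n).tensor (ρ (2 * n))

/-- The representation `⨂_{i<n} ρ_{2i+1}` on the outputs. -/
def outRep (ρ : ∀ k, URep G (Fin (d k))) : ∀ n, URep G (Out d n)
  | 0 => URep.triv G
  | n + 1 => (outRep ρ n).tensor (ρ (2 * n + 1))

/-- The representation `⨂_{j<k} ρ_j` on the first `k` systems. -/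
def sysRep (ρ : ∀ k, URep G (Fin (d k))) : ∀ k, URep G (Sys d k)
  | 0 => URep.triv G
  | k + 1 => (sysRep ρ k).tensor (ρ k)

/-- `C` commutes with `(⨂_i ρ_{2i}(g))_{𝓘^n} ⊗ (⨂_i ρ_{2i+1}(g))_{𝓞^n}` for all `g`. -/
def ChoiCovariant (ρ : ∀ k, URep G (Fin (d k))) (n : ℕ) (C : ChoiMat d n) : Prop :=
  ∀ g : G, Commute C
    (((inRep ρ n).mat g) ⊗ₖ ((outRep ρ n).mat g))

/-- `Ψ(ρ(g) X ρ(g)†) = σ̄(g) Ψ(X) σ̄(g)†` for all `g` and `X`, where `ρ = ⨂_i ρ_{2i}`,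
`σ = ⨂_i ρ_{2i+1}` and `Ψ` is the channel of `C`. -/
def ChannelCovariant (ρ : ∀ k, URep G (Fin (d k))) (n : ℕ) (C : ChoiMat d n) : Prop :=
  ∀ (g : G) (X : Matrix (In d n) (In d n) ℂ),
    channel C (((inRep ρ n).mat g) * X *
        ((inRep ρ n).mat g).conjTranspose)
      = ((outRep ρ n).conj.mat g) * channel C X *
        ((outRep ρ n).conj.mat g).conjTranspose

variable [TopologicalSpace G]

/-- The irreps appearing in `⨂_{j<k} ρ_j`: the labels stored in the register `𝓡_k`.
For `k = 0` this is the trivial irrep alone. -/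
abbrev Level (ρ : ∀ k, URep G (Fin (d k))) (k : ℕ) := Constituent (sysRep ρ k)

/-- The Clebsch–Gordan transforms used in the circuit: for every input step the generalized CG
transforms `CG_{μ, ρ_{2i}}`, and for every output step the dual CG transforms `CG_{λ, ρ̄_{2i+1}}`. -/
structure CGFamily (ρ : ∀ k, URep G (Fin (d k))) where
  fwd : ∀ (i : ℕ) (μ : Level ρ (2 * i)), CGTransform (μ.1.rep.tensor (ρ (2 * i)))
  dual : ∀ (i : ℕ) (l : Level ρ (2 * (i + 1))),
    CGTransform (l.1.rep.tensor (ρ (2 * i + 1)).conj)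

/-- Basis of `𝓡_k ⊗ 𝓥_k`, i.e. of `⨁_{λ} V_λ`: a label `λ` and a basis vector of `V_λ`. -/
abbrev IrrepReg (ρ : ∀ k, URep G (Fin (d k))) (k : ℕ) := Σ l : Level ρ k, Fin l.1.dim

/-- Basis of `𝓜_i ⊗ 𝓡_{2i} ⊗ 𝓒_{2i+1}` for a given `λ` on level `2i+1`: a memory vector, a label
`μ` on level `2i`, and a multiplicity index of `λ` in `μ ⊗ ρ_{2i}`. -/
abbrev VIn (ρ : ∀ k, URep G (Fin (d k))) (m : ℕ → ℕ) (i : ℕ) (l : Level ρ (2 * i + 1)) :=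
  Fin (m i) × (Σ μ : Level ρ (2 * i), Fin (mult l.1 (μ.1.rep.tensor (ρ (2 * i)))))

/-- Basis of `𝓜_{i+1} ⊗ 𝓡_{2i+2} ⊗ 𝓒_{2i+2}` for a given `λ` on level `2i+1`: a memory vector, a
label `ν` on level `2i+2`, and a multiplicity index of `λ` in `ν ⊗ ρ̄_{2i+1}` (this multiplicity
equals that of `ν` in `λ ⊗ ρ_{2i+1}`). -/
abbrev VOut (ρ : ∀ k, URep G (Fin (d k))) (m : ℕ → ℕ) (i : ℕ) (l : Level ρ (2 * i + 1)) :=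
  Fin (m (i + 1)) ×
    (Σ ν : Level ρ (2 * (i + 1)), Fin (mult l.1 (ν.1.rep.tensor (ρ (2 * i + 1)).conj)))

/-- Basis of the auxiliary space `𝓐_i = 𝓜_i ⊗ 𝓡_{2i} ⊗ 𝓥_{2i}`, with `𝓜_i = ℂ^{m i}`. -/
abbrev Aux (ρ : ∀ k, URep G (Fin (d k))) (m : ℕ → ℕ) (i : ℕ) := Fin (m i) × IrrepReg ρ (2 * i)

/-- The operator `W_{i+1} : 𝓐_i ⊗ 𝓘_{i+1} → 𝓐_{i+1} ⊗ 𝓞_{i+1}`. First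
`⨁_μ CG_{μ, ρ_{2i}}` is applied to `𝓡_{2i} ⊗ 𝓥_{2i} ⊗ 𝓘_{i+1}`, giving `𝓡_{2i}`, a multiplicity
register (index `a`), and a label `l` with a vector `q` of `V_l`; then, controlled on `l`, the
operator `V l` is applied to the memory, the label `μ` and `a`; finally the inverse (adjoint) of
`⨁_ν CG_{ν, ρ̄_{2i+1}}` turns the new label `ν`, the multiplicity index `b`, `l` and `q` into a
vector of `V_ν ⊗ 𝓞_{i+1}`. -/
noncomputable def stepW (ρ : ∀ k, URep G (Fin (d k))) (cg : CGFamily ρ) (m : ℕ → ℕ) (i : ℕ)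
    (V : ∀ l : Level ρ (2 * i + 1), Matrix (VOut ρ m i l) (VIn ρ m i l) ℂ) :
    Matrix (Aux ρ m (i + 1) × Fin (d (2 * i + 1))) (Aux ρ m i × Fin (d (2 * i))) ℂ :=
  Matrix.of fun out inp =>
    ∑ l : Level ρ (2 * i + 1), ∑ q : Fin l.1.dim,
      ∑ b : Fin (mult l.1 (out.1.2.1.1.rep.tensor (ρ (2 * i + 1)).conj)),
        ∑ a : Fin (mult l.1 (inp.1.2.1.1.rep.tensor (ρ (2 * i)))),
          ((cg.dual i out.1.2.1).block l.1).conjTranspose (out.1.2.2, out.2) (q, b)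
            * V l (out.1.1, ⟨out.1.2.1, b⟩) (inp.1.1, ⟨inp.1.2.1, a⟩)
            * (cg.fwd i inp.1.2.1).block l.1 (q, a) (inp.1.2.2, inp.2)

/-- The sequential circuit `W_n ⋯ W_1 : 𝓘^n → 𝓞^n ⊗ 𝓐_n`. When `m 0 = 1` the space `𝓐_0` is
one-dimensional with a single basis vector, which is the initial state. -/
noncomputable def circuit (ρ : ∀ k, URep G (Fin (d k))) (m : ℕ → ℕ)
    (W : ∀ i, Matrix (Aux ρ m (i + 1) × Fin (d (2 * i + 1))) (Aux ρ m i × Fin (d (2 * i))) ℂ) :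
    ∀ n, Matrix (Out d n × Aux ρ m n) (In d n) ℂ
  | 0 => Matrix.of fun _ _ => 1
  | n + 1 => Matrix.of fun out inp =>
      ∑ s : Aux ρ m n, W n (out.2, out.1.2) (s, inp.2) * circuit ρ m W n (out.1.1, s) inp.1

/-- The Choi matrix `∑ |x⟩⟨x'| ⊗ Tr_{𝓐} (T |x⟩⟨x'| T†)` of the channel `X ↦ Tr_{𝓐} (T X T†)`. -/
noncomputable def choiOf {I O A : Type*} [Fintype A] (T : Matrix (O × A) I ℂ) :
    Matrix (I × O) (I × O) ℂ :=
  Matrix.of fun p q => ∑ s : A, T (p.2, s) p.1 * star (T (q.2, s) q.1)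

open scoped Classical in
/-- The matrix `V` is an isometry. -/
def IsIsometry {α β : Type*} [Fintype α] (V : Matrix α β ℂ) : Prop :=
  V.conjTranspose * V = 1

/-- `C` is realized by the covariant sequential circuit built on the representations `ρ_k`:
Clebsch–Gordan transforms exist, and for each choice of them there are finite-dimensional memories
`𝓜_i = ℂ^{m i}` with `𝓜_0 = ℂ`, and isometries `V_i^λ`, such that the `W_i` are isometries and the
comb `Tr_{𝓐_n} ∘ W_n ⋯ W_1` has Choi matrix `C`. -/
def RealizedByCircuit (ρ : ∀ k, URep G (Fin (d k))) (n : ℕ) (C : ChoiMat d n) : Prop :=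
  Nonempty (CGFamily ρ) ∧
  ∀ cg : CGFamily ρ, ∃ m : ℕ → ℕ, m 0 = 1 ∧
    ∃ V : ∀ (i : ℕ) (l : Level ρ (2 * i + 1)), Matrix (VOut ρ m i l) (VIn ρ m i l) ℂ,
      (∀ i < n, ∀ l : Level ρ (2 * i + 1), IsIsometry (V i l)) ∧
      (∀ i < n, IsIsometry (stepW ρ cg m i (V i))) ∧
      choiOf (circuit ρ m (fun i => stepW ρ cg m i (V i)) n) = C

end Circuit

end QComb

/-! Transpose the output legs of the circuit W_n ⋯ W_1 to the source side: it becomes an operator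
T_n from all 2n systems to 𝓐_n (`circuitOp`), and its Choi matrix is C as soon as T_n†T_n is the
entrywise conjugate C̄ (`choiOf_circuit`). Both symmetry hypotheses say that C̄ commutes with a
tensor product representation, that of the ρ̄_k in (a) and that of the ρ_k in (b). So both parts are
instances of `realizedByCircuit`.

The heart is an induction on n (`exists_circuit`) with a stronger claim: T_n can also be taken to
intertwine the systems with ⨁_λ V_λ, the group acting trivially on the memory. Let T be such an
operator for the reduced comb. The square root of C̄ followed by a CG transform gives an intertwiner
S into 𝓐_{n+1} with S†S = C̄ (`exists_intertwiner_gram_eq`). Bending the last output of S over to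
its target traces that output out of the Gram matrix; by the comb condition the result is the Gram
matrix of T ⊗ 1. By Schur's lemma, intertwiners with equal Gram matrices differ by isometries of
multiplicity spaces, one for each λ (`CGTransform.exists_isometries`). These are the V^λ
(`exists_stepW_mul_eq`), and the new circuit operator is S itself.

Two dimension facts remain: each V^λ needs a target at least as large as its source, which large
memories provide (`exists_memory`, `card_vIn_le_card_vOut`), and W_i is an isometry because no label
leaving the forward CG transform is missing from the next level (`stepW_isIsometry`). CG transforms
exist by complete reducibility (`CGTransform.nonempty`). -/

namespace QComb

/-! ### Intertwining matrices, Schur's lemma, and the existence of CG transforms. -/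

section Intertwiners

variable {G : Type*} [Group G] {ι κ η : Type*} [Fintype ι] [DecidableEq ι] [Fintype κ]
  [DecidableEq κ] [Fintype η] [DecidableEq η]

/-- The matrix `A` is an intertwiner from `τ` to `σ`. -/
def Intertwines (τ : URep G κ) (σ : URep G ι) (A : Matrix ι κ ℂ) : Prop :=
  ∀ g, A * τ.mat g = σ.mat g * A

namespace Intertwines

variable {τ : URep G κ} {σ : URep G ι} {υ : URep G η} {A B : Matrix ι κ ℂ}

theorem conjTranspose (h : Intertwines τ σ A) : Intertwines σ τ A.conjTranspose := fun g => by
  have e := congrArg Matrix.conjTranspose (h g⁻¹)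
  simpa only [Matrix.conjTranspose_mul, URep.mat_inv, Matrix.conjTranspose_conjTranspose]
    using e.symm

theorem mul {X : Matrix κ η ℂ} (hA : Intertwines τ σ A) (hX : Intertwines υ τ X) :
    Intertwines υ σ (A * X) := fun g => by
  rw [Matrix.mul_assoc, hX g, ← Matrix.mul_assoc, hA g, Matrix.mul_assoc]

theorem zero : Intertwines τ σ (0 : Matrix ι κ ℂ) := fun g => by
  rw [Matrix.zero_mul, Matrix.mul_zero]

theorem one : Intertwines σ σ (1 : Matrix ι ι ℂ) := fun g => by
  rw [Matrix.one_mul, Matrix.mul_one]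

theorem add (hA : Intertwines τ σ A) (hB : Intertwines τ σ B) : Intertwines τ σ (A + B) :=
  fun g => by rw [Matrix.add_mul, Matrix.mul_add, hA g, hB g]

theorem smul (c : ℂ) (hA : Intertwines τ σ A) : Intertwines τ σ (c • A) :=
  fun g => by rw [Matrix.smul_mul, Matrix.mul_smul, hA g]

theorem sub (hA : Intertwines τ σ A) (hB : Intertwines τ σ B) : Intertwines τ σ (A - B) :=
  fun g => by rw [Matrix.sub_mul, Matrix.mul_sub, hA g, hB g]

theorem sum {α : Type*} (s : Finset α) {A : α → Matrix ι κ ℂ}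
    (hA : ∀ a ∈ s, Intertwines τ σ (A a)) : Intertwines τ σ (∑ a ∈ s, A a) :=
  fun g => by
    rw [Matrix.sum_mul, Matrix.mul_sum]
    exact Finset.sum_congr rfl fun a ha => hA a ha g

/-- The intertwining map given by a matrix. -/
noncomputable def toMap (h : Intertwines τ σ A) :
    Representation.IntertwiningMap τ.toRep σ.toRep :=
  { Matrix.mulVecLin A with
    isIntertwining' := fun g => by
      apply LinearMap.ext
      intro x
      change A.mulVec ((τ.mat g).mulVec x) = (σ.mat g).mulVec (A.mulVec x)
      rw [Matrix.mulVec_mulVec, Matrix.mulVec_mulVec, h g] }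

theorem toMap_apply (h : Intertwines τ σ A) (v : κ → ℂ) : h.toMap v = A.mulVec v := rfl

end Intertwines

omit [Fintype ι] [DecidableEq ι] in
theorem mulVec_ext {A B : Matrix ι κ ℂ} (h : ∀ v, A.mulVec v = B.mulVec v) : A = B :=
  Matrix.ext_of_mulVec_single fun _ => h _

/-- The space of intertwining matrices. -/
def intertwiners (τ : URep G κ) (σ : URep G ι) : Submodule ℂ (Matrix ι κ ℂ) where
  carrier := {A | Intertwines τ σ A}
  add_mem' := Intertwines.add
  zero_mem' := Intertwines.zero
  smul_mem' := fun c _ h => h.smul c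

/-- Intertwining maps are the same as intertwining matrices. -/
noncomputable def intertwinerEquiv (τ : URep G κ) (σ : URep G ι) :
    Representation.IntertwiningMap τ.toRep σ.toRep ≃ₗ[ℂ]
      intertwiners τ σ where
  toFun f := ⟨LinearMap.toMatrix' f.toLinearMap, by
    obtain ⟨A, hA, hi⟩ := intertwiner_mat τ σ f
    have : LinearMap.toMatrix' f.toLinearMap = A := mulVec_ext fun v => by
      rw [LinearMap.toMatrix'_mulVec, ← hA]; rfl
    rw [this]
    exact hi⟩
  map_add' f g := Subtype.ext (map_add LinearMap.toMatrix' f.toLinearMap g.toLinearMap)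
  map_smul' c f := Subtype.ext (map_smul LinearMap.toMatrix' c f.toLinearMap)
  invFun A := A.2.toMap
  left_inv f := by
    ext1
    exact Matrix.toLin'_toMatrix' f.toLinearMap
  right_inv A := Subtype.ext (LinearMap.toMatrix'_toLin' A.1)

variable [TopologicalSpace G]

theorem Irr.irred (l : Irr G) : l.rep.toRep.IsIrreducible := (Quotient.out l).irred

theorem Irr.dim_pos (l : Irr G) : 0 < l.dim := by
  by_contra h
  have h0 : l.dim = 0 := by omega
  have : IsEmpty (Fin l.dim) := by rw [h0]; infer_instance
  have i1 := l.irred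
  obtain ⟨a, b, hab⟩ := i1.toNontrivial
  exact hab (SetLike.ext fun x => by
    have : x = 0 := Subsingleton.elim _ _
    rw [this]
    exact ⟨fun _ => zero_mem b.toSubmodule, fun _ => zero_mem a.toSubmodule⟩)

theorem schur_scalar {l : Irr G} {A : Matrix (Fin l.dim) (Fin l.dim) ℂ}
    (h : Intertwines l.rep l.rep A) : ∃ c : ℂ, A = c • 1 := by
  have := l.irred
  obtain ⟨c, hc⟩ :=
    (Representation.IsIrreducible.algebraMap_intertwiningMap_bijective_of_isAlgClosed
      (k := ℂ) (ρ := l.rep.toRep)).2 h.toMap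
  refine ⟨c, mulVec_ext fun v => ?_⟩
  rw [← h.toMap_apply, ← hc, Matrix.smul_mulVec, Matrix.one_mulVec]
  rfl

theorem schur_zero {l l' : Irr G} (hne : l ≠ l') {A : Matrix (Fin l.dim) (Fin l'.dim) ℂ}
    (h : Intertwines l'.rep l.rep A) : A = 0 := by
  have i1 := l.irred
  have i2 := l'.irred
  have i3 : IsEmpty (Representation.Equiv l'.rep.toRep l.rep.toRep) := ⟨fun e => hne (by
    rw [← Quotient.out_eq l, ← Quotient.out_eq l']
    exact (Quotient.sound (show Nonempty _ from ⟨e⟩)).symm)⟩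
  have h0 : h.toMap = 0 := Subsingleton.elim _ _
  refine mulVec_ext fun v => ?_
  rw [← h.toMap_apply, h0, Matrix.zero_mulVec]
  rfl

theorem mult_pos_iff {l : Irr G} {σ : URep G ι} :
    0 < mult l σ ↔ ∃ A, Intertwines l.rep σ A ∧ A ≠ 0 := by
  unfold mult
  rw [(intertwinerEquiv l.rep σ).finrank_eq, Module.finrank_pos_iff, Submodule.nontrivial_iff_ne_bot,
    Submodule.ne_bot_iff]
  rfl

omit [DecidableEq κ] [DecidableEq ι] in
/-- A space of matrices has a basis that is orthonormal for the Hilbert–Schmidt inner product. -/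
theorem exists_orthonormal_matrices (H : Submodule ℂ (Matrix ι κ ℂ)) :
    ∃ X : Fin (Module.finrank ℂ H) → Matrix ι κ ℂ, (∀ a, X a ∈ H) ∧
      (∀ a b, ((X a).conjTranspose * X b).trace = if a = b then 1 else 0) ∧
      ∀ M ∈ H, ∃ c : Fin (Module.finrank ℂ H) → ℂ, M = ∑ a, c a • X a := by
  let E : Matrix ι κ ℂ ≃ₗ[ℂ] EuclideanSpace ℂ (ι × κ) :=
    (LinearEquiv.curry ℂ ℂ ι κ).symm ≪≫ₗ (WithLp.linearEquiv 2 ℂ _).symm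
  have hE : ∀ A B, inner ℂ (E A) (E B) = (A.conjTranspose * B).trace := fun A B => by
    change dotProduct _ _ = _
    simp only [dotProduct, Matrix.trace, Matrix.mul_apply, Matrix.diag_apply]
    rw [Fintype.sum_prod_type_right]
    refine Finset.sum_congr rfl fun q _ => Finset.sum_congr rfl fun i _ => ?_
    exact mul_comm _ _
  clear_value E
  have hd : Module.finrank ℂ (H.map (E : Matrix ι κ ℂ →ₗ[ℂ] EuclideanSpace ℂ (ι × κ)))
      = Module.finrank ℂ H := E.finrank_map_eq H
  let b := (stdOrthonormalBasis ℂ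
    (H.map (E : Matrix ι κ ℂ →ₗ[ℂ] EuclideanSpace ℂ (ι × κ)))).reindex (finCongr hd)
  have hb : ∀ a, ∃ X ∈ H, E X = (b a : EuclideanSpace ℂ (ι × κ)) := fun a => (b a).2
  choose X hX hXb using hb
  refine ⟨X, hX, fun a c => ?_, fun M hM => ?_⟩
  · rw [← hE, hXb, hXb]
    exact orthonormal_iff_ite.1 b.orthonormal a c
  · have hm : E M ∈ H.map (E : Matrix ι κ ℂ →ₗ[ℂ] EuclideanSpace ℂ (ι × κ)) := ⟨M, hM, rfl⟩
    refine ⟨fun a => b.repr ⟨E M, hm⟩ a, ?_⟩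
    have h2 := congrArg Subtype.val (b.sum_repr ⟨E M, hm⟩)
    apply E.injective
    rw [map_sum]
    simp only [map_smul, hXb]
    exact h2.symm.trans (by simp)

/-- By Schur, X_a†X_b is a scalar z times 1, with trace z · dim V_λ. Hence Hilbert–Schmidt
orthonormal intertwiners, rescaled by √(dim V_λ), are isometries with mutually orthogonal ranges. -/
theorem exists_orthonormal_intertwiners (l : Irr G) (σ : URep G ι) :
    ∃ A : Fin (mult l σ) → Matrix ι (Fin l.dim) ℂ,
      (∀ a, Intertwines l.rep σ (A a)) ∧
      (∀ a b, (A a).conjTranspose * A b = if a = b then 1 else 0) ∧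
      ∀ M, Intertwines l.rep σ M → ∃ c : Fin (mult l σ) → ℂ, M = ∑ a, c a • A a := by
  have hd : Module.finrank ℂ (intertwiners l.rep σ) = mult l σ :=
    ((intertwinerEquiv l.rep σ).finrank_eq).symm
  have key := exists_orthonormal_matrices (intertwiners l.rep σ)
  rw [hd] at key
  obtain ⟨X, hX, hXo, hXs⟩ := key
  have hdp : (0 : ℝ) < l.dim := Nat.cast_pos.2 l.dim_pos
  set s : ℂ := ((Real.sqrt l.dim : ℝ) : ℂ) with hs
  have hss : s * s = l.dim := by
    rw [hs, ← Complex.ofReal_mul, Real.mul_self_sqrt hdp.le]; simp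
  have hsst : star s = s := Complex.conj_ofReal _
  have hs0 : s ≠ 0 := by
    rw [hs, Complex.ofReal_ne_zero]; exact (Real.sqrt_pos.2 hdp).ne'
  refine ⟨fun a => s • X a, fun a => (hX a).smul s, fun a c => ?_, fun M hM => ?_⟩
  · obtain ⟨z, hz⟩ := schur_scalar ((hX a).conjTranspose.mul (hX c))
    have h1 := hXo a c
    rw [hz, Matrix.trace_smul, Matrix.trace_one, Fintype.card_fin, smul_eq_mul] at h1
    rw [Matrix.conjTranspose_smul, Matrix.smul_mul, Matrix.mul_smul, hz, smul_smul, smul_smul,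
      hsst, hss, mul_comm, h1]
    split_ifs <;> simp
  · obtain ⟨c, hc⟩ := hXs M hM
    refine ⟨fun a => c a * s⁻¹, ?_⟩
    simp only [smul_smul, mul_assoc, inv_mul_cancel₀ hs0, mul_one]
    exact hc

omit [DecidableEq ι] in
/-- An isometry onto a subspace. -/
theorem exists_isometry_onto (S : Submodule ℂ (ι → ℂ)) :
    ∃ (k : ℕ) (J : Matrix ι (Fin k) ℂ), J.conjTranspose * J = 1 ∧
      ∀ v, v ∈ S ↔ ∃ c, v = J.mulVec c := by
  -- Vectors are viewed as one-column matrices, whose Hilbert–Schmidt inner product is the usual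
  -- one.
  let L : Matrix ι Unit ℂ →ₗ[ℂ] (ι → ℂ) :=
    { toFun := fun A i => A i ()
      map_add' := fun _ _ => rfl
      map_smul' := fun _ _ => rfl }
  obtain ⟨X, hX, hXo, hXs⟩ := exists_orthonormal_matrices (S.comap L)
  have hJ : ∀ c, (Matrix.of fun i a => X a i ()).mulVec c = L (∑ a, c a • X a) := fun c => by
    ext i
    rw [map_sum, Finset.sum_apply]
    exact (Finset.sum_congr rfl fun a _ => mul_comm (X a i ()) (c a) :
      ∑ a, X a i () * c a = ∑ a, c a * X a i ())
  refine ⟨_, Matrix.of fun i a => X a i (), ?_, fun v => ⟨fun hv => ?_, ?_⟩⟩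
  · ext a b
    rw [Matrix.one_apply, ← hXo a b, Matrix.trace, Fintype.sum_unique]
    rfl
  · obtain ⟨c, hc⟩ := hXs (Matrix.of fun i _ => v i) hv
    exact ⟨c, by rw [hJ, ← hc]; rfl⟩
  · rintro ⟨c, rfl⟩
    rw [hJ]
    exact (S.comap L).sum_mem fun a _ => Submodule.smul_mem _ _ (hX a)

/-- The compression of a unitary representation to an invariant subspace. -/
def compress (σ : URep G ι) {k : ℕ} (J : Matrix ι (Fin k) ℂ) (hJ : J.conjTranspose * J = 1)
    (hi : ∀ g, J * (J.conjTranspose * σ.mat g * J) = σ.mat g * J) : URep G (Fin k) where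
  toFun g := ⟨J.conjTranspose * σ.mat g * J, by
    have h := hi g⁻¹
    rw [URep.mat_inv] at h
    have hu : σ.mat g * (σ.mat g).conjTranspose = 1 := Matrix.mem_unitaryGroup_iff.1 (σ g).2
    rw [Matrix.mem_unitaryGroup_iff, Matrix.star_eq_conjTranspose, Matrix.conjTranspose_mul,
      Matrix.conjTranspose_mul, Matrix.conjTranspose_conjTranspose, Matrix.mul_assoc,
      ← Matrix.mul_assoc J.conjTranspose (σ.mat g).conjTranspose, h, Matrix.mul_assoc,
      ← Matrix.mul_assoc (σ.mat g), hu, Matrix.one_mul, hJ]⟩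
  map_one' := Subtype.ext (by
    change J.conjTranspose * σ.mat 1 * J = 1
    rw [URep.mat_one, Matrix.mul_one, hJ])
  map_mul' g h := Subtype.ext (by
    change J.conjTranspose * σ.mat (g * h) * J
      = J.conjTranspose * σ.mat g * J * (J.conjTranspose * σ.mat h * J)
    rw [Matrix.mul_assoc _ J, hi h, URep.mat_mul]
    simp only [Matrix.mul_assoc])

/-- Every nonzero intertwiner `Q` into a continuous representation has a range that contains the
image of an irreducible representation. -/
theorem exists_irr_in_range {σ : URep G ι} (hσ : Continuous fun g => σ.mat g)
    {Q : Matrix ι ι ℂ} (hQ : Intertwines σ σ Q) (hQ0 : Q ≠ 0) :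
    ∃ (l : Irr G) (A : Matrix ι (Fin l.dim) ℂ), Intertwines l.rep σ A ∧ A ≠ 0 ∧
      ∀ v, ∃ w, A.mulVec v = Q.mulVec w := by
  -- A minimal nonzero invariant subspace of the range of `Q`; the compression of `σ` to it is
  -- irreducible.
  obtain ⟨S, ⟨hS0, hSR, hSi⟩, hmin⟩ := wellFounded_lt.has_min
    {S : Submodule ℂ (ι → ℂ) | S ≠ ⊥ ∧ S ≤ LinearMap.range Q.mulVecLin ∧
      ∀ g, ∀ v ∈ S, (σ.mat g).mulVec v ∈ S}
    ⟨LinearMap.range Q.mulVecLin, fun h => hQ0 (mulVec_ext fun v => by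
        rw [Matrix.zero_mulVec]
        exact (Submodule.mem_bot ℂ).1 (h ▸ ⟨v, rfl⟩)), le_rfl, by
      rintro g _ ⟨v, rfl⟩
      refine ⟨(σ.mat g).mulVec v, ?_⟩
      rw [Matrix.mulVecLin_apply, Matrix.mulVecLin_apply, Matrix.mulVec_mulVec,
        Matrix.mulVec_mulVec, hQ g]⟩
  obtain ⟨k, J, hJ, hJS⟩ := exists_isometry_onto S
  have hJJ : ∀ c, J.conjTranspose.mulVec (J.mulVec c) = c := fun c => by
    rw [Matrix.mulVec_mulVec, hJ, Matrix.one_mulVec]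
  have hi : ∀ g, J * (J.conjTranspose * σ.mat g * J) = σ.mat g * J := fun g =>
    mulVec_ext fun v => by
      obtain ⟨c, hc⟩ := (hJS _).1 (hSi g _ ((hJS _).2 ⟨v, rfl⟩))
      simp only [← Matrix.mulVec_mulVec]
      rw [hc, hJJ]
  have hint : Intertwines (compress σ J hJ hi) σ J := hi
  have hirr : (compress σ J hJ hi).toRep.IsIrreducible :=
    { exists_pair_ne := ⟨⊥, ⊤, fun h => hS0 (by
        rw [Submodule.eq_bot_iff]
        intro v hv
        obtain ⟨c, rfl⟩ := (hJS v).1 hv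
        have : c ∈ (⊥ : Subrepresentation (compress σ J hJ hi).toRep) := by
          rw [h]; exact Submodule.mem_top
        rw [show c = 0 from (Submodule.mem_bot ℂ).1 this, Matrix.mulVec_zero])⟩
      eq_bot_or_eq_top := fun T => by
        by_cases hT : T.toSubmodule = ⊥
        · left
          exact Subrepresentation.toSubmodule_injective hT
        right
        apply Subrepresentation.toSubmodule_injective
        have hle : T.toSubmodule.map J.mulVecLin ≤ S := by
          rintro _ ⟨c, -, rfl⟩
          exact (hJS _).2 ⟨c, rfl⟩
        have heq : T.toSubmodule.map J.mulVecLin = S := by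
          by_contra hne
          refine hmin _ ⟨fun h0 => hT ?_, hle.trans hSR, ?_⟩ (lt_of_le_of_ne hle hne)
          · rw [Submodule.eq_bot_iff]
            intro c hc
            have : J.mulVec c = 0 := (Submodule.mem_bot ℂ).1 (h0 ▸ ⟨c, hc, rfl⟩)
            rw [← hJJ c, this, Matrix.mulVec_zero]
          · rintro g _ ⟨c, hc, rfl⟩
            refine ⟨((compress σ J hJ hi).mat g).mulVec c, T.apply_mem_toSubmodule g hc, ?_⟩
            rw [Matrix.mulVecLin_apply, Matrix.mulVecLin_apply, Matrix.mulVec_mulVec,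
              Matrix.mulVec_mulVec, hint g]
        refine eq_top_iff.2 fun c _ => ?_
        have : J.mulVec c ∈ T.toSubmodule.map J.mulVecLin := by
          rw [heq]; exact (hJS _).2 ⟨c, rfl⟩
        obtain ⟨c', hc', h⟩ := this
        have h' : J.mulVec c' = J.mulVec c := h
        rw [← hJJ c, ← h', hJJ]
        exact hc' }
  let u : UnitaryIrrep G :=
    { dim := k
      rep := compress σ J hJ hi
      cont := (continuous_const.matrix_mul hσ).matrix_mul continuous_const
      irred := hirr }
  -- The chosen representative of the class need not be `u`, so `J` is composed with an isomorphism
  -- between the two.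
  let l : Irr G := Quotient.mk _ u
  obtain ⟨e⟩ : Nonempty (l.rep.toRep.Equiv u.rep.toRep) := Quotient.mk_out u
  obtain ⟨M, hM, hMi⟩ := intertwiner_mat _ _ e.toIntertwiningMap
  have hMi' : Intertwines l.rep u.rep M := hMi
  refine ⟨l, J * M, hint.mul hMi', fun h0 => ?_, fun v => ?_⟩
  · have hz : ∀ v, e v = 0 := fun v => by
      have h1 : e v = M.mulVec v := hM v
      rw [h1, ← hJJ (M.mulVec v), Matrix.mulVec_mulVec v J M, h0, Matrix.zero_mulVec,
        Matrix.mulVec_zero]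
    have h2 : (Pi.single (⟨0, l.dim_pos⟩ : Fin l.dim) (1 : ℂ) : Fin l.dim → ℂ) = 0 := by
      rw [← e.symm_apply_apply (Pi.single _ _), hz]
      exact map_zero e.symm.toLinearEquiv
    exact one_ne_zero (Pi.single_eq_zero_iff.1 h2)
  · obtain ⟨w, hw⟩ := hSR ((hJS _).2 ⟨M.mulVec v, rfl⟩)
    exact ⟨w, by rw [← Matrix.mulVec_mulVec]; exact hw.symm⟩

/-- Clebsch–Gordan transforms exist for continuous representations. -/
theorem CGTransform.nonempty {σ : URep G ι} (hσ : Continuous fun g => σ.mat g) :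
    Nonempty (CGTransform σ) := by
  choose A hA hAo hAs using fun l : Irr G => exists_orthonormal_intertwiners l σ
  let K : ∀ l : Irr G, Matrix (Fin l.dim × Fin (mult l σ)) ι ℂ := fun l =>
    Matrix.of fun p i => (A l p.2).conjTranspose p.1 i
  have hKK : ∀ l, (K l).conjTranspose * K l = ∑ a, A l a * (A l a).conjTranspose := fun l => by
    ext i j
    rw [Matrix.mul_apply, Fintype.sum_prod_type_right, Matrix.sum_apply]
    refine Finset.sum_congr rfl fun a _ => ?_
    rw [Matrix.mul_apply]
    refine Finset.sum_congr rfl fun q _ => ?_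
    exact congrArg (· * _) (star_star (A l a i q))
  have hKo : ∀ l l' (p : Fin l.dim × Fin (mult l σ)) (p' : Fin l'.dim × Fin (mult l' σ)),
      (K l * (K l').conjTranspose) p p' = ((A l p.2).conjTranspose * A l' p'.2) p.1 p'.1 :=
    fun l l' p p' => by
      rw [Matrix.mul_apply, Matrix.mul_apply]
      refine Finset.sum_congr rfl fun i _ => ?_
      exact congrArg (_ * ·) (star_star (A l' p'.2 i p'.1))
  refine ⟨⟨K, fun l g => ?_, fun l => ?_, fun l l' hne => ?_, ?_⟩⟩
  · ext ⟨q, a⟩ i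
    have h := congrFun (congrFun ((hA l a).conjTranspose g) q) i
    rw [Matrix.mul_apply, Matrix.mul_apply] at h
    rw [Matrix.mul_apply, Matrix.mul_apply, Fintype.sum_prod_type]
    refine h.trans (Finset.sum_congr rfl fun r _ => ?_)
    simp [Matrix.kroneckerMap_apply, Matrix.one_apply, K]
  · ext p p'
    rw [hKo, hAo, Matrix.one_apply]
    by_cases h : p.2 = p'.2
    · simp [h, Matrix.one_apply, Prod.ext_iff]
    · simp [h, Prod.ext_iff]
  · ext p p'
    rw [hKo, schur_zero hne ((hA l p.2).conjTranspose.mul (hA l' p'.2))]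
    rfl
  · simp only [hKK]
    -- `P` is the projection onto the sum of all irreducible images. If 1 - P were nonzero, its
    -- range would contain the image of a nonzero intertwiner `B` from an irreducible; then PB = B
    -- by `hPA`, while P(1 - P) = 0 forces PB = 0.
    set P := ∑ l : Constituent σ, ∑ a, A l.1 a * (A l.1 a).conjTranspose with hP
    have hPi : Intertwines σ σ P := Intertwines.sum _ fun l _ => Intertwines.sum _ fun a _ =>
      (hA l.1 a).mul (hA l.1 a).conjTranspose
    have hPA : ∀ (l : Irr G) (B : Matrix ι (Fin l.dim) ℂ), Intertwines l.rep σ B → P * B = B := by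
      intro l B hB
      by_cases hB0 : B = 0
      · rw [hB0, Matrix.mul_zero]
      obtain ⟨c, hc⟩ := hAs l B hB
      have hl : 0 < mult l σ := mult_pos_iff.2 ⟨B, hB, hB0⟩
      rw [hP, Matrix.sum_mul]
      refine (Finset.sum_eq_single (⟨l, hl⟩ : Constituent σ) ?_ ?_).trans ?_
      rotate_left 2
      · rw [Matrix.sum_mul]
        conv_rhs => rw [hc]
        refine Finset.sum_congr rfl fun a _ => ?_
        rw [Matrix.mul_assoc, hc, Matrix.mul_sum, Finset.sum_eq_single a]
        · rw [Matrix.mul_smul, hAo, if_pos rfl, Matrix.mul_smul, Matrix.mul_one]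
        · intro b _ hb
          rw [Matrix.mul_smul, hAo, if_neg hb.symm, smul_zero]
        · simp
      · intro l' _ hl'
        rw [Matrix.sum_mul]
        refine Finset.sum_eq_zero fun a _ => ?_
        rw [Matrix.mul_assoc, schur_zero (fun h => hl' (Subtype.ext h))
          ((hA l'.1 a).conjTranspose.mul hB), Matrix.mul_zero]
      · exact fun h => (h (Finset.mem_univ (α := Constituent σ) ⟨l, hl⟩)).elim
    by_contra hne
    obtain ⟨l, B, hB, hB0, hBr⟩ := exists_irr_in_range hσ (Intertwines.one.sub hPi)
      (fun h => hne (sub_eq_zero.1 h).symm)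
    have hPP : P * P = P := by
      have h : P * (∑ l : Constituent σ, ∑ a, A l.1 a * (A l.1 a).conjTranspose)
          = ∑ l : Constituent σ, ∑ a, A l.1 a * (A l.1 a).conjTranspose := by
        rw [Matrix.mul_sum]
        refine Finset.sum_congr rfl fun l _ => ?_
        rw [Matrix.mul_sum]
        refine Finset.sum_congr rfl fun a _ => ?_
        rw [← Matrix.mul_assoc, hPA _ _ (hA l.1 a)]
      exact h
    apply hB0
    rw [← hPA l B hB]
    refine mulVec_ext fun v => ?_
    obtain ⟨w, hw⟩ := hBr v
    rw [← Matrix.mulVec_mulVec, hw, Matrix.mulVec_mulVec, Matrix.mul_sub, Matrix.mul_one, hPP,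
      sub_self, Matrix.zero_mulVec, Matrix.zero_mulVec]

end Intertwiners

/-! ### Isometries from equal Gram matrices. -/

/-- Matrices with equal Gram matrices are related by an isometry. -/
theorem exists_isometry_mul_eq {α β γ : Type*} [Fintype α] [Fintype β] [Fintype γ]
    (hcard : Fintype.card α ≤ Fintype.card β) (a : Matrix α γ ℂ) (b : Matrix β γ ℂ)
    (h : a.conjTranspose * a = b.conjTranspose * b) :
    ∃ V : Matrix β α ℂ, IsIsometry V ∧ V * a = b := by
  classical
  obtain ⟨f⟩ := Function.Embedding.nonempty_of_card_le hcard
  -- `J` embeds the smaller space isometrically, so that both matrices have the same target. The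
  -- norm-preserving map Ax ↦ Bx between ranges then extends to a unitary `U` of that target, and U
  -- J is the isometry sought.
  let J : Matrix β α ℂ := Matrix.of fun y x => if y = f x then 1 else 0
  have hJ : J.conjTranspose * J = 1 := by
    ext x x'
    simp [J, Matrix.mul_apply, Matrix.one_apply, f.injective.eq_iff, eq_comm]
  have hJa : (J * a).conjTranspose * (J * a) = b.conjTranspose * b := by
    rw [Matrix.conjTranspose_mul, Matrix.mul_assoc, ← Matrix.mul_assoc _ J, hJ, Matrix.one_mul, h]
  let A := Matrix.toEuclideanLin (𝕜 := ℂ) (J * a)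
  let B := Matrix.toEuclideanLin (𝕜 := ℂ) b
  have hmul : ∀ (X : Matrix β γ ℂ), Matrix.toEuclideanLin (𝕜 := ℂ) (X.conjTranspose * X)
      = (LinearMap.adjoint (Matrix.toEuclideanLin X)) ∘ₗ (Matrix.toEuclideanLin X) := fun X => by
    rw [← Matrix.toEuclideanLin_conjTranspose_eq_adjoint]
    ext1 x
    simp [Matrix.toLpLin_apply]
  have hnorm : ∀ x, ‖A x‖ = ‖B x‖ := fun x => by
    have key : ∀ X : Matrix β γ ℂ, inner ℂ (Matrix.toEuclideanLin X x) (Matrix.toEuclideanLin X x)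
        = inner ℂ (Matrix.toEuclideanLin (X.conjTranspose * X) x) x := fun X => by
      rw [hmul, LinearMap.comp_apply, LinearMap.adjoint_inner_left]
    have e : inner ℂ (A x) (A x) = inner ℂ (B x) (B x) := by rw [key, key, hJa]
    rw [@norm_eq_sqrt_re_inner ℂ, @norm_eq_sqrt_re_inner ℂ _ _ _ _ (B x), e]
  obtain ⟨R, hR⟩ := A.rangeRestrict.exists_rightInverse_of_surjective A.range_rangeRestrict
  have hR' : ∀ s, A (R s) = s := fun s => congrArg Subtype.val (LinearMap.congr_fun hR s)
  let L : LinearMap.range A →ₗᵢ[ℂ] EuclideanSpace ℂ β :=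
    { toLinearMap := B ∘ₗ R
      norm_map' := fun s => by
        rw [LinearMap.comp_apply, ← hnorm, hR']; rfl }
  have hL : ∀ x, L.extend (A x) = B x := fun x => by
    have h1 : L.extend (A x) = L ⟨A x, x, rfl⟩ := L.extend_apply ⟨A x, x, rfl⟩
    have h2 : L ⟨A x, x, rfl⟩ = B (R ⟨A x, x, rfl⟩) := rfl
    rw [h1, h2, ← sub_eq_zero, ← map_sub, ← norm_eq_zero, ← hnorm, map_sub, hR', sub_self,
      norm_zero]
  let U : Matrix β β ℂ := Matrix.toEuclideanLin.symm L.extend.toLinearMap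
  have hU : Matrix.toEuclideanLin U = L.extend.toLinearMap := LinearEquiv.apply_symm_apply _ _
  have hUU : U.conjTranspose * U = 1 := by
    apply Matrix.toEuclideanLin.injective
    ext1 x
    refine ext_inner_right ℂ fun y => ?_
    rw [show Matrix.toEuclideanLin (U.conjTranspose * U) x
      = LinearMap.adjoint (Matrix.toEuclideanLin U) (Matrix.toEuclideanLin U x) by
        rw [← Matrix.toEuclideanLin_conjTranspose_eq_adjoint]; simp [Matrix.toLpLin_apply],
      LinearMap.adjoint_inner_left, hU]
    simp
  refine ⟨U * J, ?_, ?_⟩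
  · unfold IsIsometry
    rw [Matrix.conjTranspose_mul, Matrix.mul_assoc, ← Matrix.mul_assoc _ U, hUU, Matrix.one_mul, hJ]
  · rw [Matrix.mul_assoc]
    apply Matrix.toEuclideanLin.injective
    ext1 x
    rw [← show B x = Matrix.toEuclideanLin b x from rfl, ← hL]
    change _ = L.extend.toLinearMap (A x)
    rw [← hU]
    simp [A, Matrix.toLpLin_apply]

/-! ### Coefficients of intertwiners in the rows of a CG transform. -/

section Expansion

variable {G : Type*} [Group G] [TopologicalSpace G] {κ : Type*} [Fintype κ] [DecidableEq κ]
  {τ : URep G κ}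

/-- The intertwiner `V_τ → V_l` given by one value of the multiplicity index. -/
def CGTransform.row (K : CGTransform τ) (l : Irr G) (r : Fin (mult l τ)) :
    Matrix (Fin l.dim) κ ℂ :=
  (K.block l).submatrix (fun q => (q, r)) id

variable (K : CGTransform τ)

theorem CGTransform.row_intertwines (l : Irr G) (r : Fin (mult l τ)) :
    Intertwines τ l.rep (K.row l r) := fun g => by
  ext q i
  have h := congrFun (congrFun (K.intertwines l g) (q, r)) i
  rw [Matrix.mul_apply, Matrix.mul_apply, Fintype.sum_prod_type] at h
  rw [Matrix.mul_apply, Matrix.mul_apply]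
  refine Eq.trans h (Finset.sum_congr rfl fun p _ => ?_)
  simp [Matrix.kroneckerMap_apply, Matrix.one_apply, CGTransform.row]

theorem CGTransform.row_mul_row (l : Irr G) (r s : Fin (mult l τ)) :
    K.row l r * (K.row l s).conjTranspose = if r = s then 1 else 0 := by
  ext p q
  have h := congrFun (congrFun (K.orthonormal l) (p, r)) (q, s)
  rw [Matrix.mul_apply] at h ⊢
  refine Eq.trans h ?_
  by_cases hrs : r = s <;> simp [hrs, Matrix.one_apply]

theorem CGTransform.gram_block (l : Irr G) :
    (K.block l).conjTranspose * K.block l = ∑ r, (K.row l r).conjTranspose * K.row l r := by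
  ext i j
  rw [Matrix.mul_apply, Fintype.sum_prod_type_right, Matrix.sum_apply]
  rfl

theorem CGTransform.sum_gram_row :
    ∑ l : Constituent τ, ∑ r, (K.row l.1 r).conjTranspose * K.row l.1 r = 1 := by
  rw [← K.complete]
  exact Finset.sum_congr rfl fun l _ => (K.gram_block l.1).symm

/-- Insert the resolution of the identity by the rows after `A`: other labels vanish by Schur, and A
row_r† is a scalar, which is the coefficient. -/
theorem CGTransform.exists_expansion {l : Irr G} {A : Matrix (Fin l.dim) κ ℂ}
    (hA : Intertwines τ l.rep A) : ∃ c : Fin (mult l τ) → ℂ, A = ∑ r, c r • K.row l r := by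
  choose c hc using fun r => schur_scalar (hA.mul (K.row_intertwines l r).conjTranspose)
  refine ⟨c, ?_⟩
  by_cases hl : 0 < mult l τ
  · have h : A * (∑ l : Constituent τ, ∑ r, (K.row l.1 r).conjTranspose * K.row l.1 r) = A := by
      rw [K.sum_gram_row, Matrix.mul_one]
    rw [Matrix.mul_sum] at h
    refine h.symm.trans ((Finset.sum_eq_single (⟨l, hl⟩ : Constituent τ) ?_ ?_).trans ?_)
    · intro l' _ hl'
      rw [Matrix.mul_sum]
      refine Finset.sum_eq_zero fun r _ => ?_
      rw [← Matrix.mul_assoc, schur_zero (fun h => hl' (Subtype.ext h.symm))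
        (hA.mul (K.row_intertwines l'.1 r).conjTranspose), Matrix.zero_mul]
    · exact fun h => (h (Finset.mem_univ (α := Constituent τ) ⟨l, hl⟩)).elim
    · rw [Matrix.mul_sum]
      refine Finset.sum_congr rfl fun r _ => ?_
      rw [← Matrix.mul_assoc, hc, Matrix.smul_mul, Matrix.one_mul]
  · have hA0 : A = 0 := by
      by_contra h0
      exact hl (mult_pos_iff.2 ⟨A.conjTranspose, hA.conjTranspose, fun h => h0 (by
        rw [← Matrix.conjTranspose_conjTranspose A, h, Matrix.conjTranspose_zero])⟩)
    rw [hA0]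
    exact (Finset.sum_eq_zero fun r _ => (hl (r.pos)).elim).symm

/-- Compressing the total Gram matrix by two rows of label `l` kills all other labels and leaves an
entry of the Gram matrix of the coefficients. Thus the total Gram matrix determines the coefficient
Gram matrix of each label. -/
theorem CGTransform.row_mul_gram_mul_row {L : Type*} [Fintype L] {lab : L → Irr G}
    (hlab : Function.Injective lab) {γ : L → Type*} [∀ l, Fintype (γ l)]
    {X : ∀ l, γ l → Matrix (Fin (lab l).dim) κ ℂ} (hX : ∀ l j, Intertwines τ (lab l).rep (X l j))
    {l : L} {c : γ l → Fin (mult (lab l) τ) → ℂ}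
    (hc : ∀ j, X l j = ∑ r, c j r • K.row (lab l) r) (r s : Fin (mult (lab l) τ)) :
    K.row (lab l) r * (∑ l, ∑ j, (X l j).conjTranspose * X l j)
      * (K.row (lab l) s).conjTranspose
      = ((Matrix.of c).conjTranspose * Matrix.of c) r s • 1 := by
  have hXs : ∀ j s, X l j * (K.row (lab l) s).conjTranspose = c j s • 1 := fun j s => by
    rw [hc, Matrix.sum_mul, Finset.sum_eq_single s]
    · rw [Matrix.smul_mul, K.row_mul_row, if_pos rfl]
    · intro t _ ht
      rw [Matrix.smul_mul, K.row_mul_row, if_neg ht, smul_zero]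
    · simp
  have hXr : ∀ j s, K.row (lab l) s * (X l j).conjTranspose = star (c j s) • 1 := fun j s => by
    have e := congrArg Matrix.conjTranspose (hXs j s)
    rwa [Matrix.conjTranspose_mul, Matrix.conjTranspose_conjTranspose,
      Matrix.conjTranspose_smul, Matrix.conjTranspose_one] at e
  rw [Matrix.mul_sum, Matrix.sum_mul, Finset.sum_eq_single l]
  · rw [Matrix.mul_sum, Matrix.sum_mul, Matrix.mul_apply, Finset.sum_smul]
    refine Finset.sum_congr rfl fun j _ => ?_
    rw [← Matrix.mul_assoc, Matrix.mul_assoc, hXs, hXr, Matrix.smul_mul, Matrix.one_mul,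
      smul_smul]
    rfl
  · intro l' _ hl'
    rw [Matrix.mul_sum, Matrix.sum_mul]
    refine Finset.sum_eq_zero fun j _ => ?_
    rw [← Matrix.mul_assoc, schur_zero (fun e => hl' (hlab e).symm)
      ((K.row_intertwines (lab l) r).mul (hX l' j).conjTranspose), Matrix.zero_mul,
      Matrix.zero_mul]
  · simp

/-- Two families of intertwiners into irreducible representations with equal total Gram matrices
are related by isometries between the multiplicity spaces. -/
theorem CGTransform.exists_isometries (K : CGTransform τ) {L : Type*} [Fintype L] (lab : L → Irr G)
    (hlab : Function.Injective lab) {α β : L → Type*} [∀ l, Fintype (α l)] [∀ l, Fintype (β l)]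
    (hcard : ∀ l, Fintype.card (α l) ≤ Fintype.card (β l))
    (A : ∀ l, α l → Matrix (Fin (lab l).dim) κ ℂ) (B : ∀ l, β l → Matrix (Fin (lab l).dim) κ ℂ)
    (hA : ∀ l j, Intertwines τ (lab l).rep (A l j)) (hB : ∀ l j, Intertwines τ (lab l).rep (B l j))
    (h : ∑ l, ∑ j, (A l j).conjTranspose * A l j = ∑ l, ∑ j, (B l j).conjTranspose * B l j)
    (l : L) : ∃ V : Matrix (β l) (α l) ℂ, IsIsometry V ∧ ∀ j, B l j = ∑ i, V j i • A l i := by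
  choose a ha using fun j => K.exists_expansion (hA l j)
  choose b hb using fun j => K.exists_expansion (hB l j)
  obtain ⟨V, hV, hVa⟩ := exists_isometry_mul_eq (hcard l) (Matrix.of a) (Matrix.of b) (by
    ext r s
    have e := (K.row_mul_gram_mul_row hlab hA ha r s).symm.trans
      (h ▸ K.row_mul_gram_mul_row hlab hB hb r s)
    -- A diagonal entry of the scalar matrix reads off the scalar; it exists since V_λ is nonzero.
    have e2 := congrFun (congrFun e ⟨0, (lab l).dim_pos⟩) ⟨0, (lab l).dim_pos⟩
    simpa using e2)
  refine ⟨V, hV, fun j => ?_⟩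
  have hbj : ∀ r, b j r = ∑ i, V j i * a i r := fun r =>
    (congrFun (congrFun hVa j) r).symm
  rw [hb]
  simp only [hbj, ha, Finset.sum_smul, Finset.smul_sum, smul_smul]
  exact Finset.sum_comm

end Expansion

/-! ### Tensor products, bending of legs, and labels of tensor products. -/

section Tensor

variable {G : Type*} [Group G] {ι κ η o : Type*} [Fintype ι] [DecidableEq ι] [Fintype κ]
  [DecidableEq κ] [Fintype η] [DecidableEq η] [Fintype o] [DecidableEq o]

theorem URep.tensor_mat (σ : URep G ι) (τ : URep G κ) (g : G) :
    (σ.tensor τ).mat g = σ.mat g ⊗ₖ τ.mat g := rfl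

theorem URep.conj_mat (σ : URep G ι) (g : G) :
    σ.conj.mat g = (σ.mat g).map (starRingEnd ℂ) := rfl

theorem Intertwines.tensor_one {τ : URep G κ} {σ : URep G ι} {A : Matrix ι κ ℂ}
    (h : Intertwines τ σ A) (υ : URep G o) :
    Intertwines (τ.tensor υ) (σ.tensor υ) (A ⊗ₖ (1 : Matrix o o ℂ)) := fun g => by
  rw [URep.tensor_mat, URep.tensor_mat, ← Matrix.mul_kronecker_mul, ← Matrix.mul_kronecker_mul,
    h g, Matrix.one_mul, Matrix.mul_one]

/-- Move the second tensor factor of the source to the target. -/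
def bend {α β γ : Type*} (M : Matrix α (β × γ) ℂ) : Matrix (α × γ) β ℂ :=
  Matrix.of fun p e => M p.1 (e, p.2)

/-- By unitarity the action on the second source factor passes to the other side as υ†; read on the
target index, υ† acts as its transpose ῡ. This is why the output step uses the dual CG transform. -/
theorem Intertwines.bend {τ : URep G κ} {υ : URep G o} {ν : URep G ι} {M : Matrix ι (κ × o) ℂ}
    (h : Intertwines (τ.tensor υ) ν M) : Intertwines τ (ν.tensor υ.conj) (bend M) := fun g => by
  have hu : υ.mat g * (υ.mat g).conjTranspose = 1 := Matrix.mem_unitaryGroup_iff.1 (υ g).2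
  have e : M * (τ.mat g ⊗ₖ (1 : Matrix o o ℂ))
      = ν.mat g * M * ((1 : Matrix κ κ ℂ) ⊗ₖ (υ.mat g).conjTranspose) := by
    rw [← h g, URep.tensor_mat, Matrix.mul_assoc, ← Matrix.mul_kronecker_mul, hu, Matrix.mul_one]
  ext ⟨v, b⟩ z
  have e1 := congrFun (congrFun e v) (z, b)
  rw [Matrix.mul_apply, Fintype.sum_prod_type, Matrix.mul_apply, Fintype.sum_prod_type] at e1
  rw [Matrix.mul_apply, Matrix.mul_apply, Fintype.sum_prod_type]
  simp only [Matrix.kroneckerMap_apply, Matrix.one_apply, mul_ite, mul_one, mul_zero,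
    Finset.sum_ite_eq', Finset.mem_univ, if_true, ite_mul, one_mul, zero_mul,
    Finset.sum_ite_irrel, Finset.sum_const_zero] at e1
  refine Eq.trans e1 ?_
  simp only [Matrix.mul_apply, Finset.sum_mul]
  rw [Finset.sum_comm]
  refine Finset.sum_congr rfl fun v' _ => Finset.sum_congr rfl fun b' _ => ?_
  simp only [QComb.bend, Matrix.of_apply, URep.tensor_mat, URep.conj_mat,
    Matrix.kroneckerMap_apply, Matrix.map_apply, Matrix.conjTranspose_apply, starRingEnd_apply]
  ring

variable [TopologicalSpace G]

/-- By Schur a nonzero f : V_μ → V_σ has f†f a nonzero scalar, so f ⊗ 1 is injective and carries a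
copy of V_l in μ ⊗ υ into σ ⊗ υ. Hence the labels leaving a forward CG transform all lie on the next
level. -/
theorem mult_pos_tensor {σ : URep G κ} {υ : URep G o} {μ l : Irr G} (hμ : 0 < mult μ σ)
    (hl : 0 < mult l (μ.rep.tensor υ)) : 0 < mult l (σ.tensor υ) := by
  obtain ⟨f, hf, hf0⟩ := mult_pos_iff.1 hμ
  obtain ⟨h, hh, hh0⟩ := mult_pos_iff.1 hl
  obtain ⟨c, hc⟩ := schur_scalar (hf.conjTranspose.mul hf)
  have hc0 : c ≠ 0 := by
    rintro rfl
    rw [zero_smul, Matrix.conjTranspose_mul_self_eq_zero] at hc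
    exact hf0 hc
  refine mult_pos_iff.2 ⟨_, (hf.tensor_one υ).mul hh, fun h0 => hh0 ?_⟩
  have e : (f.conjTranspose ⊗ₖ (1 : Matrix o o ℂ)) * ((f ⊗ₖ (1 : Matrix o o ℂ)) * h) = c • h := by
    rw [← Matrix.mul_assoc, ← Matrix.mul_kronecker_mul, hc, Matrix.one_mul, Matrix.smul_kronecker,
      Matrix.one_kronecker_one, Matrix.smul_mul, Matrix.one_mul]
  rw [h0, Matrix.mul_zero] at e
  exact (smul_eq_zero.1 e.symm).resolve_left hc0

/-- For f : V_l → V_σ, bending a row of label ν and composing with `f` gives an intertwiner V_l → ν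
⊗ ῡ. If all of these vanished, every row would kill f ⊗ 1, and completeness would give f = 0. This
makes the target of V^λ nonzero. -/
theorem exists_dual_constituent [Nonempty o] {σ : URep G κ} {υ : URep G o}
    (K : CGTransform (σ.tensor υ)) {l : Irr G} (hl : 0 < mult l σ) :
    ∃ ν : Constituent (σ.tensor υ), 0 < mult l (ν.1.rep.tensor υ.conj) := by
  obtain ⟨f, hf, hf0⟩ := mult_pos_iff.1 hl
  by_contra! hno
  have hz : ∀ (ν : Constituent (σ.tensor υ)) r,
      K.row ν.1 r * (f ⊗ₖ (1 : Matrix o o ℂ)) = 0 := fun ν r => by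
    have hb : bend (K.row ν.1 r) * f = 0 := by
      by_contra h0
      exact (mult_pos_iff.2 ⟨_, (K.row_intertwines ν.1 r).bend.mul hf, h0⟩).not_ge (hno ν)
    ext v ⟨q, b⟩
    have e := congrFun (congrFun hb (v, b)) q
    rw [Matrix.mul_apply] at e
    rw [Matrix.mul_apply, Fintype.sum_prod_type]
    refine Eq.trans ?_ e
    simp [Matrix.one_apply, bend]
  have h1 : f ⊗ₖ (1 : Matrix o o ℂ) = 0 := by
    rw [← Matrix.one_mul (f ⊗ₖ (1 : Matrix o o ℂ)), ← K.sum_gram_row, Matrix.sum_mul]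
    refine Finset.sum_eq_zero fun ν _ => ?_
    rw [Matrix.sum_mul]
    refine Finset.sum_eq_zero fun r _ => ?_
    rw [Matrix.mul_assoc, hz, Matrix.mul_zero]
  obtain ⟨b⟩ := ‹Nonempty o›
  refine hf0 (Matrix.ext fun i q => ?_)
  have := congrFun (congrFun h1 (i, b)) (q, b)
  simpa using this

/-- A sum independent of the index type lets the constituents of μ ⊗ ρ be exchanged for those of the
whole system, which index the controlled operators. -/
theorem sum_constituent_eq_finsum {M : Type*} [AddCommMonoid M] (σ : URep G ι) (f : Irr G → M)
    (hf : ∀ l, ¬ 0 < mult l σ → f l = 0) : ∑ l : Constituent σ, f l.1 = ∑ᶠ l, f l := by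
  let emb : Constituent σ ↪ Irr G := ⟨fun l => l.1, fun _ _ h => Subtype.ext h⟩
  rw [finsum_eq_sum_of_support_subset (s := Finset.univ.map emb), Finset.sum_map]
  · rfl
  · intro l hl
    have : 0 < mult l σ := by
      by_contra h
      exact hl (hf l h)
    rw [Finset.coe_map]
    exact ⟨⟨l, this⟩, Finset.mem_coe.2 (Finset.mem_univ (α := Constituent σ) _), rfl⟩

/-- Completeness of a Clebsch–Gordan transform, with the labels taken from another
representation. -/
theorem CGTransform.sum_row_mul {σ : URep G ι} (K : CGTransform σ) (τ : URep G κ) {ε : Type*}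
    (X : Matrix ι ε ℂ) (h : ∀ l, ¬ 0 < mult l τ → ∀ r, K.row l r * X = 0) :
    ∑ l : Constituent τ, ∑ r, (K.row l.1 r).conjTranspose * (K.row l.1 r * X) = X := by
  rw [sum_constituent_eq_finsum τ
      (fun l => ∑ r, (K.row l r).conjTranspose * (K.row l r * X)) (fun l hl => by
        exact Finset.sum_eq_zero fun r _ => by rw [h l hl, Matrix.mul_zero]),
    ← sum_constituent_eq_finsum σ _ (fun l hl => Finset.sum_eq_zero fun r _ => (hl r.pos).elim)]
  conv_rhs => rw [← Matrix.one_mul X, ← K.sum_gram_row, Matrix.sum_mul]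
  simp only [Matrix.sum_mul, Matrix.mul_assoc]

end Tensor

/-! ### One step of the circuit. -/

section Step

variable {G : Type*} [Group G] [TopologicalSpace G] {d : ℕ → ℕ} {ρ : ∀ k, URep G (Fin (d k))}
  {m : ℕ → ℕ}

/-- The component of an operator into `𝓜_i ⊗ (⨁_λ V_λ) ⊗ ℂ^o` with a given memory vector and
label. -/
noncomputable def fiber {M k o : ℕ} {ε : Type*}
    (X : Matrix ((Fin M × IrrepReg ρ k) × Fin o) ε ℂ) (a : Fin M) (μ : Level ρ k) : Matrix (Fin μ.1.dim × Fin o) ε ℂ :=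
  X.submatrix (fun p => ((a, ⟨μ, p.1⟩), p.2)) id

theorem fiber_ext {M k o : ℕ} {ε : Type*} {X Y : Matrix ((Fin M × IrrepReg ρ k) × Fin o) ε ℂ}
    (h : ∀ a μ, fiber X a μ = fiber Y a μ) : X = Y := by
  ext ⟨⟨a, ⟨μ, v⟩⟩, b⟩ e
  exact congrFun (congrFun (h a μ) (v, b)) e

theorem gram_eq_sum_fiber {M k o : ℕ} {ε : Type*}
    (X : Matrix ((Fin M × IrrepReg ρ k) × Fin o) ε ℂ) :
    X.conjTranspose * X = ∑ a, ∑ μ, (fiber X a μ).conjTranspose * fiber X a μ := by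
  ext e e'
  simp only [Matrix.mul_apply, Matrix.sum_apply, Fintype.sum_prod_type, Fintype.sum_sigma]
  rfl

/-- The family of rows of a controlled Clebsch–Gordan transform applied to `X`. -/
noncomputable def rowsOf {M k o : ℕ} {ε : Type*} {σ : URep G (Fin o)}
    (K : ∀ μ : Level ρ k, CGTransform (μ.1.rep.tensor σ))
    (X : Matrix ((Fin M × IrrepReg ρ k) × Fin o) ε ℂ) (l : Irr G)
    (j : Fin M × (Σ μ : Level ρ k, Fin (mult l (μ.1.rep.tensor σ)))) :
    Matrix (Fin l.dim) ε ℂ :=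
  (K j.2.1).row l j.2.2 * fiber X j.1 j.2.1

theorem sum_gram_rowsOf {M k o : ℕ} {ε κ : Type*} [Fintype κ] [DecidableEq κ]
    {σ : URep G (Fin o)} (K : ∀ μ : Level ρ k, CGTransform (μ.1.rep.tensor σ))
    (X : Matrix ((Fin M × IrrepReg ρ k) × Fin o) ε ℂ) (τ : URep G κ)
    (h : ∀ l, ¬ 0 < mult l τ → ∀ j, rowsOf K X l j = 0) :
    ∑ l : Constituent τ, ∑ j, (rowsOf K X l.1 j).conjTranspose * rowsOf K X l.1 j
      = X.conjTranspose * X := by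
  rw [gram_eq_sum_fiber]
  simp only [Fintype.sum_prod_type, Fintype.sum_sigma]
  rw [Finset.sum_comm]
  refine Finset.sum_congr rfl fun a _ => ?_
  rw [Finset.sum_comm]
  refine Finset.sum_congr rfl fun μ _ => ?_
  conv_rhs =>
    enter [2]
    rw [← (K μ).sum_row_mul τ (fiber X a μ) fun l hl r => h l hl (a, ⟨μ, r⟩)]
  rw [Matrix.mul_sum]
  refine Finset.sum_congr rfl fun l _ => ?_
  rw [Matrix.mul_sum]
  refine Finset.sum_congr rfl fun r _ => ?_
  rw [rowsOf, Matrix.conjTranspose_mul, Matrix.mul_assoc]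

theorem sum_mul_mul_comm {α β γ : Type*} [Fintype α] [Fintype β] [Fintype γ] (v : γ → ℂ)
    (r : γ → α → β → ℂ) (f : α → β → ℂ) :
    ∑ w, ∑ x, ∑ c, v c * r c w x * f w x = ∑ c, v c * ∑ w, ∑ x, r c w x * f w x := by
  simp only [Finset.mul_sum, ← mul_assoc]
  exact Finset.sum_comm_cycle

/-- Expresses W X in the rows of the dual CG transform: its coefficients are those of X in the
forward rows, mixed by V^λ. -/
theorem fiber_stepW_mul (cg : CGFamily ρ) (i : ℕ)
    (V : ∀ l : Level ρ (2 * i + 1), Matrix (VOut ρ m i l) (VIn ρ m i l) ℂ) {ε : Type*}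
    (X : Matrix (Aux ρ m i × Fin (d (2 * i))) ε ℂ) (a : Fin (m (i + 1)))
    (ν : Level ρ (2 * (i + 1))) :
    fiber (stepW ρ cg m i V * X) a ν = ∑ l : Level ρ (2 * i + 1), ∑ b,
      ((cg.dual i ν).row l.1 b).conjTranspose
        * ∑ j, V l (a, ⟨ν, b⟩) j • rowsOf (cg.fwd i) X l.1 j := by
  have hY : ∀ (l : Level ρ (2 * i + 1)) (b : Fin (mult l.1 (ν.1.rep.tensor (ρ (2 * i + 1)).conj))),
      (Matrix.of fun (q : Fin l.1.dim) (inp : Aux ρ m i × Fin (d (2 * i))) =>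
        ∑ c : Fin (mult l.1 (inp.1.2.1.1.rep.tensor (ρ (2 * i)))),
          V l (a, ⟨ν, b⟩) (inp.1.1, ⟨inp.1.2.1, c⟩)
            * (cg.fwd i inp.1.2.1).block l.1 (q, c) (inp.1.2.2, inp.2)) * X
      = ∑ j, V l (a, ⟨ν, b⟩) j • rowsOf (cg.fwd i) X l.1 j := fun l b => by
    ext q e
    rw [Matrix.mul_apply, Matrix.sum_apply]
    simp only [Fintype.sum_prod_type, Fintype.sum_sigma]
    refine Finset.sum_congr rfl fun k _ => Finset.sum_congr rfl fun μ _ => ?_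
    simp only [Matrix.of_apply, Finset.sum_mul, Matrix.smul_apply, rowsOf, Matrix.mul_apply,
      Fintype.sum_prod_type, smul_eq_mul]
    exact sum_mul_mul_comm (fun c => V l (a, ⟨ν, b⟩) (k, ⟨μ, c⟩))
      (fun c w x => (cg.fwd i μ).block l.1 (q, c) (w, x)) fun w x => X ((k, ⟨μ, w⟩), x) e
  simp only [← hY, ← Matrix.mul_assoc, ← Matrix.sum_mul]
  ext p e
  refine (Matrix.mul_apply ..).trans ((Matrix.mul_apply ..).trans ?_).symm
  refine Finset.sum_congr rfl fun inp _ => congrArg (· * X inp e) ?_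
  simp only [Matrix.sum_apply, Matrix.mul_apply, stepW, Matrix.of_apply, Finset.mul_sum]
  refine Finset.sum_congr rfl fun l _ => ?_
  rw [Finset.sum_comm]
  refine Finset.sum_congr rfl fun q _ => Finset.sum_congr rfl fun b _ =>
    Finset.sum_congr rfl fun c _ => ?_
  rw [mul_assoc]
  rfl

theorem CGTransform.row_mul_sum {κ η : Type*} [Fintype κ] [DecidableEq κ] [Fintype η]
    [DecidableEq η] {σ : URep G κ} (K : CGTransform σ) {τ : URep G η} {ε : Type*}
    (Y : ∀ (l : Constituent τ), Fin (mult l.1 σ) → Matrix (Fin l.1.dim) ε ℂ) (l : Constituent τ)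
    (r : Fin (mult l.1 σ)) :
    K.row l.1 r * ∑ l', ∑ s, (K.row l'.1 s).conjTranspose * Y l' s = Y l r := by
  rw [Matrix.mul_sum, Finset.sum_eq_single l]
  · rw [Matrix.mul_sum, Finset.sum_eq_single r]
    · rw [← Matrix.mul_assoc, K.row_mul_row, if_pos rfl, Matrix.one_mul]
    · intro s _ hs
      rw [← Matrix.mul_assoc, K.row_mul_row, if_neg hs.symm, Matrix.zero_mul]
    · simp
  · intro l' _ hl'
    rw [Matrix.mul_sum]
    refine Finset.sum_eq_zero fun s _ => ?_
    rw [← Matrix.mul_assoc, schur_zero (fun e => hl' (Subtype.ext e.symm))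
      ((K.row_intertwines l.1 r).mul (K.row_intertwines l'.1 s).conjTranspose), Matrix.zero_mul]
  · simp

theorem CGTransform.gram_sum_row {κ η : Type*} [Fintype κ] [DecidableEq κ] [Fintype η]
    [DecidableEq η] {σ : URep G κ} (K : CGTransform σ) {τ : URep G η} {ε : Type*}
    (Y : ∀ (l : Constituent τ), Fin (mult l.1 σ) → Matrix (Fin l.1.dim) ε ℂ) :
    (∑ l, ∑ r, (K.row l.1 r).conjTranspose * Y l r).conjTranspose
        * ∑ l, ∑ r, (K.row l.1 r).conjTranspose * Y l r
      = ∑ l, ∑ r, (Y l r).conjTranspose * Y l r := by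
  rw [Matrix.conjTranspose_sum, Matrix.sum_mul]
  refine Finset.sum_congr rfl fun l _ => ?_
  rw [Matrix.conjTranspose_sum, Matrix.sum_mul]
  refine Finset.sum_congr rfl fun r _ => ?_
  rw [Matrix.conjTranspose_mul, Matrix.conjTranspose_conjTranspose, Matrix.mul_assoc,
    K.row_mul_sum]

theorem gram_of_fiber {M k o : ℕ} {ε κ : Type*} [Fintype κ] [DecidableEq κ]
    {σ : URep G (Fin o)} (K : ∀ μ : Level ρ k, CGTransform (μ.1.rep.tensor σ)) {τ : URep G κ}
    (X : Matrix ((Fin M × IrrepReg ρ k) × Fin o) ε ℂ)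
    (Z : ∀ l : Constituent τ, (Fin M × (Σ μ : Level ρ k, Fin (mult l.1 (μ.1.rep.tensor σ)))) →
      Matrix (Fin l.1.dim) ε ℂ)
    (h : ∀ a μ, fiber X a μ
      = ∑ l, ∑ r, ((K μ).row l.1 r).conjTranspose * Z l (a, ⟨μ, r⟩)) :
    X.conjTranspose * X = ∑ l, ∑ j, (Z l j).conjTranspose * Z l j := by
  rw [gram_eq_sum_fiber]
  simp only [Fintype.sum_prod_type, Fintype.sum_sigma]
  conv_rhs => rw [Finset.sum_comm]
  refine Finset.sum_congr rfl fun a _ => ?_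
  conv_rhs => rw [Finset.sum_comm]
  refine Finset.sum_congr rfl fun μ _ => ?_
  rw [h]
  exact (K μ).gram_sum_row fun l r => Z l (a, ⟨μ, r⟩)

theorem IsIsometry.sum_gram {α β ι ε : Type*} [Fintype α] [Fintype β] [Fintype ι]
    {V : Matrix β α ℂ} (hV : IsIsometry V) (R : α → Matrix ι ε ℂ) :
    ∑ j, (∑ i, V j i • R i).conjTranspose * ∑ i, V j i • R i
      = ∑ i, (R i).conjTranspose * R i := by
  classical
  have h : ∀ i i', ∑ j, star (V j i) * V j i' = if i = i' then 1 else 0 := fun i i' => by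
    have := congrFun (congrFun hV i) i'
    rw [Matrix.mul_apply] at this
    refine this.trans ?_
    rw [Matrix.one_apply]
  simp only [Matrix.conjTranspose_sum, Matrix.sum_mul, Matrix.mul_sum, Matrix.conjTranspose_smul,
    Matrix.smul_mul, Matrix.mul_smul, smul_smul, Finset.smul_sum]
  rw [Finset.sum_comm]
  refine Finset.sum_congr rfl fun i _ => ?_
  rw [Finset.sum_comm]
  simp only [← Finset.sum_smul]
  rw [Finset.sum_eq_single i]
  · rw [show ∑ j, V j i * star (V j i) = 1 by simpa [mul_comm] using h i i, one_smul]
  · intro i' _ hi'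
    rw [show ∑ j, V j i * star (V j i') = 0 by simpa [mul_comm, hi'] using h i' i, zero_smul]
  · simp

/-- The operator of a step is an isometry whenever the controlled operators are. -/
theorem stepW_isIsometry (cg : CGFamily ρ) (i : ℕ)
    {V : ∀ l : Level ρ (2 * i + 1), Matrix (VOut ρ m i l) (VIn ρ m i l) ℂ}
    (hV : ∀ l, IsIsometry (V l)) : IsIsometry (stepW ρ cg m i V) := by
  classical
  -- With X = 1 the formula for W X computes the Gram matrix of W itself.
  let X : Matrix (Aux ρ m i × Fin (d (2 * i))) (Aux ρ m i × Fin (d (2 * i))) ℂ := 1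
  have h1 := sum_gram_rowsOf (cg.fwd i) X
    (sysRep ρ (2 * i + 1)) fun l hl j => (hl (mult_pos_tensor j.2.1.2 j.2.2.pos)).elim
  have h2 := gram_of_fiber (cg.dual i) (τ := sysRep ρ (2 * i + 1)) (stepW ρ cg m i V * X)
    (fun l j => ∑ j', V l j j' • rowsOf (cg.fwd i) X l.1 j') fun a ν => fiber_stepW_mul cg i V X a ν
  rw [Matrix.mul_one] at h2
  unfold IsIsometry
  rw [h2]
  simp only [(hV _).sum_gram]
  rw [h1, Matrix.conjTranspose_one, Matrix.one_mul]
  congr!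

/-- An intertwining target operator of a step is reached by a choice of controlled isometries. -/
theorem exists_stepW_mul_eq (cg : CGFamily ρ) (i : ℕ)
    (hcard : ∀ l : Level ρ (2 * i + 1), Fintype.card (VIn ρ m i l) ≤ Fintype.card (VOut ρ m i l))
    {X : Matrix (Aux ρ m i × Fin (d (2 * i))) (Sys d (2 * i + 1)) ℂ}
    {S : Matrix (Aux ρ m (i + 1) × Fin (d (2 * i + 1))) (Sys d (2 * i + 1)) ℂ}
    (K : CGTransform (sysRep ρ (2 * i + 1)))
    (hX : ∀ a μ, Intertwines (sysRep ρ (2 * i + 1)) (μ.1.rep.tensor (ρ (2 * i))) (fiber X a μ))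
    (hS : ∀ a ν, Intertwines (sysRep ρ (2 * i + 1)) (ν.1.rep.tensor (ρ (2 * i + 1)).conj)
      (fiber S a ν))
    (h : X.conjTranspose * X = S.conjTranspose * S) :
    ∃ V : ∀ l : Level ρ (2 * i + 1), Matrix (VOut ρ m i l) (VIn ρ m i l) ℂ,
      (∀ l, IsIsometry (V l)) ∧ stepW ρ cg m i V * X = S := by
  have hXi : ∀ l j, Intertwines (sysRep ρ (2 * i + 1)) l.rep (rowsOf (cg.fwd i) X l j) :=
    fun l j => ((cg.fwd i j.2.1).row_intertwines l j.2.2).mul (hX _ _)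
  have hSi : ∀ l j, Intertwines (sysRep ρ (2 * i + 1)) l.rep (rowsOf (cg.dual i) S l j) :=
    fun l j => ((cg.dual i j.2.1).row_intertwines l j.2.2).mul (hS _ _)
  -- Labels absent from level 2i+1 carry no intertwiner out of the systems, so controlling on that
  -- level alone loses nothing of `X` or `S`.
  have hzero : ∀ (l : Irr G), ¬ 0 < mult l (sysRep ρ (2 * i + 1)) → ∀ Y,
      Intertwines (sysRep ρ (2 * i + 1)) l.rep Y → Y = 0 := fun l hl Y hY => by
    by_contra h0
    exact hl (mult_pos_iff.2 ⟨Y.conjTranspose, hY.conjTranspose, fun h => h0 (by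
      rw [← Matrix.conjTranspose_conjTranspose Y, h, Matrix.conjTranspose_zero])⟩)
  choose V hV hVB using K.exists_isometries (fun l : Level ρ (2 * i + 1) => l.1)
    (fun _ _ h => Subtype.ext h) (α := fun l => VIn ρ m i l) (β := fun l => VOut ρ m i l) hcard
    (fun l => rowsOf (cg.fwd i) X l.1) (fun l => rowsOf (cg.dual i) S l.1)
    (fun l => hXi l.1) (fun l => hSi l.1) (by
      rw [sum_gram_rowsOf _ _ _ fun l hl j => hzero l hl _ (hXi l j),
        sum_gram_rowsOf _ _ _ fun l hl j => hzero l hl _ (hSi l j), h])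
  refine ⟨V, hV, fiber_ext fun a ν => ?_⟩
  rw [fiber_stepW_mul]
  simp only [← hVB]
  exact (cg.dual i ν).sum_row_mul (sysRep ρ (2 * i + 1)) (fiber S a ν)
    fun l hl r => hzero l hl _ (hSi l (a, ⟨ν, r⟩))

end Step

/-! ### Temporal order versus inputs-then-outputs. -/

section Systems

variable (d : ℕ → ℕ)

/-- Reordering of the systems: inputs first, then outputs. -/
def sysEquiv : ∀ n, Sys d (2 * n) ≃ In d n × Out d n
  | 0 => (Equiv.prodUnique Unit Unit).symm
  | n + 1 =>
    { toFun := fun (z : (Sys d (2 * n) × Fin (d (2 * n))) × Fin (d (2 * n + 1))) =>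
        (((sysEquiv n z.1.1).1, z.1.2), ((sysEquiv n z.1.1).2, z.2))
      invFun := fun p => (((sysEquiv n).symm (p.1.1, p.2.1), p.1.2), p.2.2)
      left_inv := fun (z : (Sys d (2 * n) × Fin (d (2 * n))) × Fin (d (2 * n + 1))) => by simp
      right_inv := fun p => by simp }

variable {d}

variable {G : Type*} [Group G] (ρ : ∀ k, URep G (Fin (d k)))

theorem sysRep_mat (g : G) : ∀ n, (sysRep ρ (2 * n)).mat g
    = ((inRep ρ n).mat g ⊗ₖ (outRep ρ n).mat g).submatrix (sysEquiv d n) (sysEquiv d n)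
  | 0 => by
    ext z z'
    change (1 : Matrix Unit Unit ℂ) z z'
      = (1 : Matrix Unit Unit ℂ) () () * (1 : Matrix Unit Unit ℂ) () ()
    simp
  | n + 1 => by
    ext z z'
    obtain ⟨⟨z, a⟩, b⟩ : (Sys d (2 * n) × Fin (d (2 * n))) × Fin (d (2 * n + 1)) := z
    obtain ⟨⟨z', a'⟩, b'⟩ : (Sys d (2 * n) × Fin (d (2 * n))) × Fin (d (2 * n + 1)) := z'
    have ih := congrFun (congrFun (sysRep_mat g n) z) z'
    change (sysRep ρ (2 * n)).mat g z z' * (ρ (2 * n)).mat g a a' * (ρ (2 * n + 1)).mat g b b'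
      = ((inRep ρ n).mat g (sysEquiv d n z).1 (sysEquiv d n z').1 * (ρ (2 * n)).mat g a a')
        * ((outRep ρ n).mat g (sysEquiv d n z).2 (sysEquiv d n z').2 * (ρ (2 * n + 1)).mat g b b')
    rw [ih]
    simp only [Matrix.submatrix_apply, Matrix.kroneckerMap_apply]
    ring

theorem sysRep_continuous [TopologicalSpace G] {ρ : ∀ k, URep G (Fin (d k))}
    (hρ : ∀ k, Continuous fun g => (ρ k).mat g) : ∀ k, Continuous fun g => (sysRep ρ k).mat g
  | 0 => continuous_const
  | k + 1 => by
    have ih := sysRep_continuous hρ k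
    refine continuous_matrix fun i j => ?_
    exact (ih.matrix_elem i.1 j.1).mul ((hρ k).matrix_elem i.2 j.2)

end Systems

/-! ### Comb conditions and covariance for the conjugate Choi matrix. -/

section Combs

variable {d : ℕ → ℕ}

/-- The complex conjugate of a Choi matrix, with the systems in temporal order. -/
def conjChoi {n : ℕ} (C : ChoiMat d n) : Matrix (Sys d (2 * n)) (Sys d (2 * n)) ℂ :=
  Matrix.of fun z z' => star (C (sysEquiv d n z) (sysEquiv d n z'))

theorem conjChoi_posSemidef {n : ℕ} {C : ChoiMat d n} (hC : C.PosSemidef) :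
    (conjChoi C).PosSemidef := by
  have h : conjChoi C = C.transpose.submatrix (sysEquiv d n) (sysEquiv d n) := by
    ext z z'
    exact hC.1.apply (sysEquiv d n z') (sysEquiv d n z)
  rw [h]
  exact hC.transpose.submatrix _

theorem reduce_posSemidef {n : ℕ} {C : ChoiMat d (n + 1)} (hC : C.PosSemidef) :
    (reduce C).PosSemidef := by
  have h : reduce C = (d (2 * n) : ℂ)⁻¹ • ∑ a : Fin (d (2 * n)), ∑ b : Fin (d (2 * n + 1)),
      C.submatrix (fun p : In d n × Out d n => ((p.1, a), (p.2, b)))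
        (fun p : In d n × Out d n => ((p.1, a), (p.2, b))) := by
    ext p q
    simp [reduce, Matrix.sum_apply]
  rw [h]
  refine Matrix.PosSemidef.smul (Matrix.posSemidef_sum _ fun a _ =>
    Matrix.posSemidef_sum _ fun b _ => hC.submatrix _) ?_
  positivity

theorem IsComb.reduce {n : ℕ} {C : ChoiMat d (n + 1)} (hC : IsComb (n + 1) C) :
    IsComb n (reduce C) :=
  ⟨reduce_posSemidef hC.1, hC.2.2⟩

/-- A zero comb would have zero reductions all the way down, against C_0 = 1. -/
theorem IsComb.ne_zero : ∀ {n : ℕ} {C : ChoiMat d n}, IsComb n C → C ≠ 0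
  | 0, C, hC => by
    rw [show C = 1 from hC.2]
    exact one_ne_zero
  | n + 1, C, hC => by
    rintro rfl
    refine IsComb.ne_zero hC.reduce ?_
    ext p q
    simp [QComb.reduce]

/-- An output of dimension 0 would make the partial trace an empty sum, hence the reduced comb zero.
-/
theorem IsComb.dim_pos {n : ℕ} {C : ChoiMat d (n + 1)} (hC : IsComb (n + 1) C) :
    0 < d (2 * n + 1) := by
  by_contra h
  have h0 : d (2 * n + 1) = 0 := by omega
  have : IsEmpty (Fin (d (2 * n + 1))) := by rw [h0]; infer_instance
  refine hC.reduce.ne_zero ?_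
  ext p q
  simp [QComb.reduce]

variable {G : Type*} [Group G] {ρ : ∀ k, URep G (Fin (d k))}

/-- The Choi matrix commutes with the conjugate representation. -/
def ConjCovariant (ρ : ∀ k, URep G (Fin (d k))) (n : ℕ) (C : ChoiMat d n) : Prop :=
  Intertwines (sysRep ρ (2 * n)) (sysRep ρ (2 * n)) (conjChoi C)

theorem conjChoi_trace {n : ℕ} {C : ChoiMat d (n + 1)} (hC : IsComb (n + 1) C)
    (z z' : Sys d (2 * n)) (a a' : Fin (d (2 * n))) :
    ∑ b : Fin (d (2 * n + 1)), conjChoi C ((z, a), b) ((z', a'), b)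
      = (conjChoi (reduce C) ⊗ₖ (1 : Matrix (Fin (d (2 * n))) (Fin (d (2 * n))) ℂ))
        (z, a) (z', a') := by
  have h := congrArg star (hC.2.1 (sysEquiv d n z).1 (sysEquiv d n z').1 (sysEquiv d n z).2
    (sysEquiv d n z').2 a a')
  rw [star_sum] at h
  refine Eq.trans h ?_
  rw [Matrix.kroneckerMap_apply, Matrix.one_apply]
  split_ifs
  · rw [mul_one]; rfl
  · simp

theorem conjChoi_reduce {n : ℕ} (C : ChoiMat d (n + 1)) (z z' : Sys d (2 * n)) :
    conjChoi (reduce C) z z' = (d (2 * n) : ℂ)⁻¹ * ∑ a : Fin (d (2 * n)),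
      ∑ b : Fin (d (2 * n + 1)), conjChoi C ((z, a), b) ((z', a), b) := by
  simp only [conjChoi, Matrix.of_apply, reduce, star_mul', star_sum, star_inv₀, star_natCast]
  rfl

/-- Cyclicity of the trace over the discarded factor cancels υ(g) against υ(g)†. -/
theorem partialTrace_intertwines {κ o : Type*} [Fintype κ] [DecidableEq κ] [Fintype o]
    [DecidableEq o] {σ : URep G κ} {υ : URep G o} {A : Matrix (κ × o) (κ × o) ℂ}
    (h : Intertwines (σ.tensor υ) (σ.tensor υ) A) :
    Intertwines σ σ (Matrix.of fun z z' => ∑ b, A (z, b) (z', b)) := fun g => by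
  have hu : υ.mat g * (υ.mat g).conjTranspose = 1 := Matrix.mem_unitaryGroup_iff.1 (υ g).2
  have hu' : (υ.mat g).conjTranspose * υ.mat g = 1 := Matrix.mem_unitaryGroup_iff'.1 (υ g).2
  let blk : Matrix (κ × o) (κ × o) ℂ → κ → κ → Matrix o o ℂ := fun B z z' =>
    B.submatrix (fun b => (z, b)) (fun b => (z', b))
  have h1 : ∀ z z', blk (A * (σ.tensor υ).mat g) z z'
      = ∑ x, σ.mat g x z' • (blk A z x * υ.mat g) := fun z z' => by
    ext b b'
    simp only [blk, Matrix.submatrix_apply, Matrix.mul_apply, Fintype.sum_prod_type,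
      Matrix.sum_apply, Matrix.smul_apply, URep.tensor_mat, Matrix.kroneckerMap_apply,
      smul_eq_mul, Finset.mul_sum]
    exact Finset.sum_congr rfl fun x _ => Finset.sum_congr rfl fun c _ => by ring
  have h2 : ∀ z z', blk ((σ.tensor υ).mat g * A) z z'
      = ∑ x, σ.mat g z x • (υ.mat g * blk A x z') := fun z z' => by
    ext b b'
    simp only [blk, Matrix.submatrix_apply, Matrix.mul_apply, Fintype.sum_prod_type,
      Matrix.sum_apply, Matrix.smul_apply, URep.tensor_mat, Matrix.kroneckerMap_apply,
      smul_eq_mul, Finset.mul_sum]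
    exact Finset.sum_congr rfl fun x _ => Finset.sum_congr rfl fun c _ => by ring
  ext z z'
  have h3 := congrArg (fun B => (blk B z z' * (υ.mat g).conjTranspose).trace) (h g)
  simp only [h1, h2, Matrix.sum_mul, Matrix.smul_mul, Matrix.trace_sum, Matrix.trace_smul] at h3
  simp only [Matrix.mul_assoc, hu, Matrix.mul_one] at h3
  simp only [Matrix.trace_mul_comm (υ.mat g), Matrix.mul_assoc, hu', Matrix.mul_one] at h3
  rw [Matrix.mul_apply, Matrix.mul_apply]
  refine Eq.trans (Finset.sum_congr rfl fun x _ => mul_comm _ _) h3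

theorem ConjCovariant.reduce {n : ℕ} {C : ChoiMat d (n + 1)} (h : ConjCovariant ρ (n + 1) C) :
    ConjCovariant ρ n (reduce C) := by
  have h1 : Intertwines (((sysRep ρ (2 * n)).tensor (ρ (2 * n))).tensor (ρ (2 * n + 1)))
    (((sysRep ρ (2 * n)).tensor (ρ (2 * n))).tensor (ρ (2 * n + 1))) (conjChoi C) := h
  have h2 := (partialTrace_intertwines (partialTrace_intertwines h1)).smul (d (2 * n) : ℂ)⁻¹
  have h3 : conjChoi (QComb.reduce C) = (d (2 * n) : ℂ)⁻¹ • Matrix.of fun z z' =>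
      ∑ a, (Matrix.of fun (z z' : Sys d (2 * n) × Fin (d (2 * n))) =>
        ∑ b : Fin (d (2 * n + 1)), conjChoi C (z, b) (z', b)) (z, a) (z', a) := by
    ext z z'
    exact conjChoi_reduce C z z'
  unfold ConjCovariant
  rw [h3]
  exact h2

theorem inRep_conj_mat (g : G) : ∀ n, (inRep (fun k => (ρ k).conj) n).mat g
    = ((inRep ρ n).mat g).map (starRingEnd ℂ)
  | 0 => by
    change (1 : Matrix Unit Unit ℂ) = (1 : Matrix Unit Unit ℂ).map (starRingEnd ℂ)
    rw [Matrix.map_one _ (map_zero _) (map_one _)]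
  | n + 1 => by
    ext p q
    have ih := congrFun (congrFun (inRep_conj_mat g n) p.1) q.1
    change (inRep (fun k => (ρ k).conj) n).mat g p.1 q.1 * _
      = starRingEnd ℂ ((inRep ρ n).mat g p.1 q.1 * (ρ (2 * n)).mat g p.2 q.2)
    rw [ih, map_mul]
    rfl

theorem outRep_conj_mat (g : G) : ∀ n, (outRep (fun k => (ρ k).conj) n).mat g
    = ((outRep ρ n).mat g).map (starRingEnd ℂ)
  | 0 => by
    change (1 : Matrix Unit Unit ℂ) = (1 : Matrix Unit Unit ℂ).map (starRingEnd ℂ)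
    rw [Matrix.map_one _ (map_zero _) (map_one _)]
  | n + 1 => by
    ext p q
    have ih := congrFun (congrFun (outRep_conj_mat g n) p.1) q.1
    change (outRep (fun k => (ρ k).conj) n).mat g p.1 q.1 * _
      = starRingEnd ℂ ((outRep ρ n).mat g p.1 q.1 * (ρ (2 * n + 1)).mat g p.2 q.2)
    rw [ih, map_mul]
    rfl

theorem conjChoi_eq {n : ℕ} (C : ChoiMat d n) :
    conjChoi C = (C.map (starRingEnd ℂ)).submatrix (sysEquiv d n) (sysEquiv d n) := rfl

theorem conjCovariant_iff {n : ℕ} {C : ChoiMat d n} : ConjCovariant ρ n C ↔ ∀ g,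
    C.map (starRingEnd ℂ) * ((inRep ρ n).mat g ⊗ₖ (outRep ρ n).mat g)
      = ((inRep ρ n).mat g ⊗ₖ (outRep ρ n).mat g) * C.map (starRingEnd ℂ) := by
  unfold ConjCovariant Intertwines
  simp only [conjChoi_eq, sysRep_mat, Matrix.submatrix_mul_equiv]
  exact forall_congr' fun g =>
    ⟨fun h => by simpa using congrArg (·.submatrix (sysEquiv d n).symm (sysEquiv d n).symm) h,
      fun h => by rw [h]⟩

theorem ChoiCovariant.conjCovariant {n : ℕ} {C : ChoiMat d n} (h : ChoiCovariant ρ n C) :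
    ConjCovariant (fun k => (ρ k).conj) n C := by
  rw [conjCovariant_iff]
  intro g
  have e := congrArg (fun B => B.map (starRingEnd ℂ)) (h g).eq
  simp only [Matrix.map_mul] at e
  have hk : ((inRep (fun k => (ρ k).conj) n).mat g ⊗ₖ (outRep (fun k => (ρ k).conj) n).mat g)
      = ((inRep ρ n).mat g ⊗ₖ (outRep ρ n).mat g).map (starRingEnd ℂ) := by
    rw [inRep_conj_mat, outRep_conj_mat]
    ext p q
    simp
  rw [hk]
  exact e

theorem kronecker_one_mul_mul_apply {α β : Type*} [Fintype α] [Fintype β] [DecidableEq β]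
    (A B : Matrix α α ℂ) (M : Matrix (α × β) (α × β) ℂ) (a b : α) (y y' : β) :
    ((A ⊗ₖ (1 : Matrix β β ℂ)) * M * (B ⊗ₖ (1 : Matrix β β ℂ))) (a, y) (b, y')
      = ∑ i, ∑ j, A a i * M (i, y) (j, y') * B j b := by
  rw [Finset.sum_comm]
  simp [Matrix.mul_apply, Fintype.sum_prod_type, Matrix.one_apply, Finset.sum_mul]

theorem one_kronecker_mul_mul_apply {α β : Type*} [Fintype α] [Fintype β] [DecidableEq α]
    (A B : Matrix β β ℂ) (M : Matrix (α × β) (α × β) ℂ) (a b : α) (y y' : β) :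
    (((1 : Matrix α α ℂ) ⊗ₖ A) * M * ((1 : Matrix α α ℂ) ⊗ₖ B)) (a, y) (b, y')
      = ∑ i, ∑ j, A y i * M (a, i) (b, j) * B j y' := by
  rw [Finset.sum_comm]
  simp [Matrix.mul_apply, Fintype.sum_prod_type, Matrix.one_apply, Finset.sum_mul]

theorem ChannelCovariant.conjCovariant {n : ℕ} {C : ChoiMat d n} (h : ChannelCovariant ρ n C) :
    ConjCovariant ρ n C := by
  rw [conjCovariant_iff]
  intro g
  set R := (inRep ρ n).mat g with hR
  set S := (outRep ρ n).mat g with hS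
  have hRu : R * R.conjTranspose = 1 := Matrix.mem_unitaryGroup_iff.1 (inRep ρ n g).2
  have hSu : S.conjTranspose * S = 1 := Matrix.mem_unitaryGroup_iff'.1 (outRep ρ n g).2
  have key : (R.conjTranspose ⊗ₖ (1 : Matrix (Out d n) (Out d n) ℂ)) * C.map (starRingEnd ℂ)
        * (R ⊗ₖ (1 : Matrix (Out d n) (Out d n) ℂ))
      = ((1 : Matrix (In d n) (In d n) ℂ) ⊗ₖ S) * C.map (starRingEnd ℂ)
        * ((1 : Matrix (In d n) (In d n) ℂ) ⊗ₖ S.conjTranspose) := by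
    ext ⟨a, y⟩ ⟨b, y'⟩
    -- Covariance is tested on the matrix units |a⟩⟨b|, which yield the blocks of C; conjugation
    -- turns σ̄ into σ.
    have e := congrArg star (congrFun (congrFun (h g (Matrix.single a b 1)) y) y')
    rw [kronecker_one_mul_mul_apply, one_kronecker_mul_mul_apply]
    have e1 : channel C (R * Matrix.single a b 1 * R.conjTranspose) y y'
        = ∑ i, ∑ j, R i a * star (R j b) * C (i, y) (j, y') := by
      simp [channel, Matrix.mul_apply, Matrix.single_apply, ite_and]
    have e2 : ((outRep ρ n).conj.mat g * channel C (Matrix.single a b 1)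
        * ((outRep ρ n).conj.mat g).conjTranspose) y y'
        = ∑ w, ∑ w', star (S y w) * C (a, w) (b, w') * S y' w' := by
      have e3 : ∀ w w', channel C (Matrix.single a b 1) w w' = C (a, w) (b, w') := fun w w' => by
        simp [channel, Matrix.single_apply, ite_and, Finset.sum_ite_irrel]
      rw [Matrix.mul_apply]
      simp only [Matrix.mul_apply, e3, Finset.sum_mul]
      rw [Finset.sum_comm]
      refine Finset.sum_congr rfl fun w _ => Finset.sum_congr rfl fun w' _ => ?_
      exact congrArg (fun t => star (S y w) * C (a, w) (b, w') * t) (star_star (S y' w'))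
    rw [e1, e2] at e
    simp only [star_sum, star_mul', star_star] at e
    refine Eq.trans ?_ (e.trans ?_)
    · refine Finset.sum_congr rfl fun i _ => Finset.sum_congr rfl fun j _ => ?_
      simp only [Matrix.conjTranspose_apply, Matrix.map_apply, starRingEnd_apply]
      ring
    · rfl
  -- Multiplying by R ⊗ 1 on the left and 1 ⊗ S on the right gives the commutation of C̄ with R ⊗ S.
  have h1 := congrArg (fun B => (R ⊗ₖ (1 : Matrix (Out d n) (Out d n) ℂ)) * B
    * ((1 : Matrix (In d n) (In d n) ℂ) ⊗ₖ S)) key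
  simp only [← Matrix.mul_assoc, ← Matrix.mul_kronecker_mul, hRu, Matrix.mul_one, Matrix.one_mul,
    Matrix.one_kronecker_one] at h1
  simpa only [Matrix.mul_assoc, ← Matrix.mul_kronecker_mul, hSu, Matrix.mul_one, Matrix.one_mul,
    Matrix.one_kronecker_one] using h1

end Combs

open scoped MatrixOrder Matrix.Norms.L2Operator in
/-- A positive semidefinite matrix is a Gram matrix of a matrix in its bicommutant. -/
theorem exists_sqrt {κ : Type*} [Fintype κ] [DecidableEq κ] {A : Matrix κ κ ℂ}
    (hA : A.PosSemidef) :
    ∃ R : Matrix κ κ ℂ, R.conjTranspose * R = A ∧ ∀ B, Commute A B → Commute R B := by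
  refine ⟨CFC.sqrt A, ?_, fun B hB => ?_⟩
  · rw [(Matrix.nonneg_iff_posSemidef.1 (CFC.sqrt_nonneg A)).1.eq]
    exact CFC.sqrt_mul_sqrt_self A hA.nonneg
  · exact hB.cfcₙ_nnreal NNReal.sqrt

/-! ### Covariant square roots and memory dimensions. -/

section Memory

variable {G : Type*} [Group G] [TopologicalSpace G] {d : ℕ → ℕ} {ρ : ∀ k, URep G (Fin (d k))}
  {m : ℕ → ℕ}

/-- The component of an operator into `𝓜 ⊗ (⨁_λ V_λ)` with a given memory vector and label. -/
noncomputable def component {M k : ℕ} {ε : Type*} (T : Matrix (Fin M × IrrepReg ρ k) ε ℂ)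
    (a : Fin M) (μ : Level ρ k) : Matrix (Fin μ.1.dim) ε ℂ :=
  T.submatrix (fun q => (a, ⟨μ, q⟩)) id

theorem gram_eq_sum_component {M k : ℕ} {ε : Type*} (T : Matrix (Fin M × IrrepReg ρ k) ε ℂ) :
    T.conjTranspose * T = ∑ a, ∑ μ, (component T a μ).conjTranspose * component T a μ := by
  ext e e'
  simp only [Matrix.mul_apply, Matrix.sum_apply, Fintype.sum_prod_type, Fintype.sum_sigma]
  rfl

/-- A covariant positive operator is the Gram matrix of an intertwiner into
`𝓜 ⊗ (⨁_λ V_λ)` if the memory is large enough. -/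
theorem exists_intertwiner_gram_eq {M k : ℕ} (K : CGTransform (sysRep ρ k))
    (hM : ∀ l : Level ρ k, mult l.1 (sysRep ρ k) ≤ M) {A : Matrix (Sys d k) (Sys d k) ℂ}
    (hA : A.PosSemidef) (hAi : Intertwines (sysRep ρ k) (sysRep ρ k) A) :
    ∃ S : Matrix (Fin M × IrrepReg ρ k) (Sys d k) ℂ, S.conjTranspose * S = A ∧
      ∀ a μ, Intertwines (sysRep ρ k) μ.1.rep (component S a μ) := by
  obtain ⟨R, hRR, hRi⟩ : ∃ R : Matrix (Sys d k) (Sys d k) ℂ, R.conjTranspose * R = A ∧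
      Intertwines (sysRep ρ k) (sysRep ρ k) R := by
    obtain ⟨R, hR, hRc⟩ := exists_sqrt hA
    exact ⟨R, hR, fun g => hRc _ (hAi g)⟩
  -- The memory stores the multiplicity index of the CG transform of all systems; memory vectors
  -- beyond the multiplicity get zero.
  let S : Matrix (Fin M × IrrepReg ρ k) (Sys d k) ℂ := Matrix.of fun s z =>
    if h : s.1.1 < mult s.2.1.1 (sysRep ρ k) then
      (K.row s.2.1.1 ⟨s.1.1, h⟩ * R) s.2.2 z else 0
  have hS : ∀ a μ, component S a μ = if h : a.1 < mult μ.1 (sysRep ρ k) then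
      K.row μ.1 ⟨a.1, h⟩ * R else 0 := fun a μ => by
    ext q z
    simp only [component, S, Matrix.submatrix_apply, Matrix.of_apply, id]
    split_ifs <;> rfl
  refine ⟨S, ?_, fun a μ => ?_⟩
  · rw [gram_eq_sum_component, Finset.sum_comm]
    have h1 : ∀ μ : Level ρ k, ∑ a, (component S a μ).conjTranspose * component S a μ
        = R.conjTranspose * (∑ r, (K.row μ.1 r).conjTranspose * K.row μ.1 r) * R := fun μ => by
      rw [Matrix.mul_sum, Matrix.sum_mul]
      symm
      refine Fintype.sum_of_injective (Fin.castLE (hM μ)) (Fin.castLE_injective _) _ _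
        (fun a ha => ?_) fun r => ?_
      · rw [hS, dif_neg fun h => ha ⟨⟨a.1, h⟩, rfl⟩, Matrix.mul_zero]
      · rw [hS, dif_pos (by exact r.2), Matrix.conjTranspose_mul]
        simp only [Matrix.mul_assoc]
        rfl
    simp only [h1]
    rw [← Matrix.sum_mul, ← Matrix.mul_sum]
    exact (congrArg (fun B => R.conjTranspose * B * R) K.sum_gram_row).trans
      (by rw [Matrix.mul_one, hRR])
  · rw [hS]
    split_ifs
    · exact (K.row_intertwines _ _).mul hRi
    · exact Intertwines.zero

/-- There is a choice of memory dimensions that is large enough for every step. -/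
theorem exists_memory (ρ : ∀ k, URep G (Fin (d k))) : ∃ m : ℕ → ℕ, m 0 = 1 ∧
    (∀ i, ∀ l : Level ρ (2 * (i + 1)), mult l.1 (sysRep ρ (2 * (i + 1))) ≤ m (i + 1)) ∧
    ∀ i, ∀ l : Level ρ (2 * i + 1), Fintype.card (VIn ρ m i l) ≤ m (i + 1) := by
  -- The first sum bounds every multiplicity, making room for `S`; the second bounds every source of
  -- V^λ, given the previous memory.
  let m : ℕ → ℕ := fun i => Nat.rec 1 (fun i M =>
    (∑ l : Level ρ (2 * (i + 1)), mult l.1 (sysRep ρ (2 * (i + 1)))) +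
      ∑ l : Level ρ (2 * i + 1),
        M * Fintype.card (Σ μ : Level ρ (2 * i), Fin (mult l.1 (μ.1.rep.tensor (ρ (2 * i)))))) i
  have hm : ∀ i, m (i + 1) = (∑ l : Level ρ (2 * (i + 1)), mult l.1 (sysRep ρ (2 * (i + 1)))) +
      ∑ l : Level ρ (2 * i + 1),
        m i * Fintype.card (Σ μ : Level ρ (2 * i), Fin (mult l.1 (μ.1.rep.tensor (ρ (2 * i))))) :=
    fun _ => rfl
  refine ⟨m, rfl, fun i l => ?_, fun i l => ?_⟩
  · rw [hm]
    exact (Finset.single_le_sum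
      (f := fun l : Level ρ (2 * (i + 1)) => mult l.1 (sysRep ρ (2 * (i + 1))))
      (fun _ _ => Nat.zero_le _) (Finset.mem_univ l)).trans (Nat.le_add_right _ _)
  · rw [Fintype.card_prod, Fintype.card_fin, hm]
    exact (Finset.single_le_sum (f := fun l : Level ρ (2 * i + 1) => m i * Fintype.card
        (Σ μ : Level ρ (2 * i), Fin (mult l.1 (μ.1.rep.tensor (ρ (2 * i))))))
      (fun _ _ => Nat.zero_le _) (Finset.mem_univ l)).trans (Nat.le_add_left _ _)

theorem card_vIn_le_card_vOut (hm : ∀ i, ∀ l : Level ρ (2 * i + 1),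
      Fintype.card (VIn ρ m i l) ≤ m (i + 1)) (i : ℕ) (hd : 0 < d (2 * i + 1))
    (K : CGTransform (sysRep ρ (2 * (i + 1)))) (l : Level ρ (2 * i + 1)) :
    Fintype.card (VIn ρ m i l) ≤ Fintype.card (VOut ρ m i l) := by
  have : Nonempty (Fin (d (2 * i + 1))) := ⟨⟨0, hd⟩⟩
  obtain ⟨ν, hν⟩ := exists_dual_constituent (σ := sysRep ρ (2 * i + 1)) (υ := ρ (2 * i + 1)) K l.2
  refine (hm i l).trans ?_
  rw [Fintype.card_prod, Fintype.card_fin]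
  refine Nat.le_mul_of_pos_right _ (Fintype.card_pos_iff.2 ⟨⟨ν, ⟨0, hν⟩⟩⟩)

end Memory

theorem CGTransform.sum_mult_mul_dim {G ι : Type*} [Group G] [TopologicalSpace G] [Fintype ι]
    [DecidableEq ι] {σ : URep G ι} (K : CGTransform σ) :
    ∑ l : Constituent σ, mult l.1 σ * l.1.dim = Fintype.card ι := by
  have h := congrArg Matrix.trace K.sum_gram_row
  rw [Matrix.trace_sum, Matrix.trace_one] at h
  have h1 : ∀ l : Constituent σ, (∑ r, (K.row l.1 r).conjTranspose * K.row l.1 r).trace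
      = ((mult l.1 σ * l.1.dim : ℕ) : ℂ) := fun l => by
    rw [Matrix.trace_sum]
    simp [Matrix.trace_mul_comm, K.row_mul_row]
  simp only [h1] at h
  exact_mod_cast h

/-! ### The circuit operator, the induction, and the theorem. -/

section Circuits

variable {G : Type*} [Group G] [TopologicalSpace G] {d : ℕ → ℕ} {ρ : ∀ k, URep G (Fin (d k))}
  {m : ℕ → ℕ}

/-- The circuit as an operator from all systems, in temporal order, to the auxiliary space. -/
noncomputable def circuitOp (ρ : ∀ k, URep G (Fin (d k))) (m : ℕ → ℕ)
    (W : ∀ i, Matrix (Aux ρ m (i + 1) × Fin (d (2 * i + 1))) (Aux ρ m i × Fin (d (2 * i))) ℂ)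
    (n : ℕ) : Matrix (Aux ρ m n) (Sys d (2 * n)) ℂ :=
  Matrix.of fun s z => circuit ρ m W n ((sysEquiv d n z).2, s) (sysEquiv d n z).1

variable {W W' : ∀ i, Matrix (Aux ρ m (i + 1) × Fin (d (2 * i + 1)))
  (Aux ρ m i × Fin (d (2 * i))) ℂ}

theorem circuit_congr : ∀ {n : ℕ}, (∀ i < n, W i = W' i) → circuit ρ m W n = circuit ρ m W' n
  | 0, _ => rfl
  | n + 1, h => by
    simp only [circuit]
    rw [circuit_congr fun i hi => h i (Nat.lt_succ_of_lt hi), h n (Nat.lt_succ_self n)]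

theorem circuitOp_congr {n : ℕ} (h : ∀ i < n, W i = W' i) :
    circuitOp ρ m W n = circuitOp ρ m W' n := by
  unfold circuitOp
  rw [circuit_congr h]

/-- The recursion of the induction: the new input enters through T ⊗ 1, and the new output is a
target leg of W_n until bent back. -/
theorem bend_circuitOp_succ (n : ℕ) :
    bend (circuitOp ρ m W (n + 1) :
      Matrix (Aux ρ m (n + 1)) (Sys d (2 * n + 1) × Fin (d (2 * n + 1))) ℂ)
      = W n * (circuitOp ρ m W n ⊗ₖ (1 : Matrix (Fin (d (2 * n))) (Fin (d (2 * n))) ℂ) :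
        Matrix (Aux ρ m n × Fin (d (2 * n))) (Sys d (2 * n + 1)) ℂ) := by
  ext ⟨s, b⟩ z
  obtain ⟨z, a⟩ : Sys d (2 * n) × Fin (d (2 * n)) := z
  rw [Matrix.mul_apply, Fintype.sum_prod_type]
  simp only [Matrix.kroneckerMap_apply, Matrix.one_apply, mul_ite, mul_one, mul_zero,
    Finset.sum_ite_eq', Finset.mem_univ, if_true]
  rfl

theorem circuitOp_succ_eq {n : ℕ}
    {S : Matrix (Aux ρ m (n + 1)) (Sys d (2 * n + 1) × Fin (d (2 * n + 1))) ℂ}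
    (h : W n * (circuitOp ρ m W n ⊗ₖ (1 : Matrix (Fin (d (2 * n))) (Fin (d (2 * n))) ℂ) :
        Matrix (Aux ρ m n × Fin (d (2 * n))) (Sys d (2 * n + 1)) ℂ) = bend S) :
    circuitOp ρ m W (n + 1) = S := by
  have h2 := (bend_circuitOp_succ n).trans h
  ext s z
  exact congrFun (congrFun h2 (s, z.2)) z.1

theorem choiOf_circuit {n : ℕ} {C : ChoiMat d n}
    (h : (circuitOp ρ m W n).conjTranspose * circuitOp ρ m W n = conjChoi C) :
    choiOf (circuit ρ m W n) = C := by
  ext p q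
  have e := congrArg star (congrFun (congrFun h ((sysEquiv d n).symm p)) ((sysEquiv d n).symm q))
  simp only [conjChoi, Matrix.of_apply, star_star, Equiv.apply_symm_apply] at e
  rw [← e, Matrix.mul_apply, star_sum]
  refine Finset.sum_congr rfl fun s _ => ?_
  simp [circuitOp]

/-- Multiplicities times dimensions sum to 1, so exactly one label occurs and its irrep has
dimension 1. -/
theorem card_irrepReg_zero (ρ : ∀ k, URep G (Fin (d k))) : Fintype.card (IrrepReg ρ 0) = 1 := by
  obtain ⟨K⟩ := CGTransform.nonempty (σ := sysRep ρ 0) continuous_const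
  have h1 : ∑ l : Constituent (sysRep ρ 0), mult l.1 (sysRep ρ 0) * l.1.dim = 1 := K.sum_mult_mul_dim
  rw [Fintype.card_sigma]
  simp only [Fintype.card_fin]
  have h2 : ∑ l : Constituent (sysRep ρ 0), l.1.dim ≤ 1 := by
    rw [← h1]
    exact Finset.sum_le_sum fun l _ => Nat.le_mul_of_pos_left _ l.2
  have h3 : ∑ l : Constituent (sysRep ρ 0), l.1.dim ≠ 0 := fun h => by
    rw [Finset.sum_eq_zero fun l hl => by rw [(Finset.sum_eq_zero_iff.1 h) l hl, mul_zero]] at h1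
    exact zero_ne_one h1
  change ∑ l : Constituent (sysRep ρ 0), l.1.dim = 1
  omega

theorem circuitOp_zero_gram (hm : m 0 = 1) {C : ChoiMat d 0} (hC : C = 1) :
    (circuitOp ρ m W 0).conjTranspose * circuitOp ρ m W 0 = conjChoi C := by
  ext z z'
  have h1 : Fintype.card (Aux ρ m 0) = 1 := by
    rw [Fintype.card_prod, Fintype.card_fin, hm, one_mul]
    exact card_irrepReg_zero ρ
  rw [Matrix.mul_apply, hC]
  have h2 : ∀ s, (circuitOp ρ m W 0).conjTranspose z s * circuitOp ρ m W 0 s z' = 1 := fun s => by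
    simp [circuitOp, circuit]
  simp only [h2, Finset.sum_const, Finset.card_univ, h1]
  simp [conjChoi]

/-- Source and target are one-dimensional, so the constant 1 is a scalar multiple of any nonzero
intertwiner, and the choice of representative of the trivial irrep is harmless. -/
theorem circuitOp_zero_intertwines (a : Fin (m 0)) (μ : Level ρ 0) :
    Intertwines (sysRep ρ 0) μ.1.rep (component (circuitOp ρ m W 0) a μ) := by
  have hs : Subsingleton (IrrepReg ρ 0) :=
    Fintype.card_le_one_iff_subsingleton.1 (card_irrepReg_zero ρ).le
  have hq : ∀ q q' : Fin μ.1.dim, q = q' := fun q q' =>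
    eq_of_heq (Sigma.mk.inj_iff.1 (hs.elim ⟨μ, q⟩ ⟨μ, q'⟩)).2
  obtain ⟨A, hA, hA0⟩ := mult_pos_iff.1 μ.2
  let q0 : Fin μ.1.dim := ⟨0, μ.1.dim_pos⟩
  have hAq : ∀ z q, A z q = A () q0 := fun z q => by rw [hq q q0]
  have hc : star (A () q0) ≠ 0 := star_ne_zero.2 fun h => hA0 (Matrix.ext fun z q => by
    rw [hAq, h]; rfl)
  have h : component (circuitOp ρ m W 0) a μ = (star (A () q0))⁻¹ • A.conjTranspose := by
    ext q z
    exact ((congrArg (fun t => (star (A () q0))⁻¹ * star t) (hAq z q)).trans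
      (inv_mul_cancel₀ hc)).symm
  rw [h]
  exact hA.conjTranspose.smul _

theorem gram_bend {α β γ : Type*} [Fintype α] [Fintype γ] (M : Matrix α (β × γ) ℂ) (z z' : β) :
    ((bend M).conjTranspose * bend M) z z'
      = ∑ b, (M.conjTranspose * M) (z, b) (z', b) := by
  simp only [Matrix.mul_apply, Fintype.sum_prod_type]
  exact Finset.sum_comm

/-- A covariant comb is realized by a circuit of controlled isometries. -/
theorem exists_circuit (hρ : ∀ k, Continuous fun g => (ρ k).mat g) (cg : CGFamily ρ)
    (hm0 : m 0 = 1)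
    (hm1 : ∀ i, ∀ l : Level ρ (2 * (i + 1)), mult l.1 (sysRep ρ (2 * (i + 1))) ≤ m (i + 1))
    (hm2 : ∀ i, ∀ l : Level ρ (2 * i + 1), Fintype.card (VIn ρ m i l) ≤ m (i + 1)) :
    ∀ (n : ℕ) (C : ChoiMat d n), IsComb n C → ConjCovariant ρ n C →
    ∃ V : ∀ (i : ℕ) (l : Level ρ (2 * i + 1)), Matrix (VOut ρ m i l) (VIn ρ m i l) ℂ,
      (∀ i < n, ∀ l, IsIsometry (V i l)) ∧
      (∀ a μ, Intertwines (sysRep ρ (2 * n)) μ.1.rep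
        (component (circuitOp ρ m (fun i => stepW ρ cg m i (V i)) n) a μ)) ∧
      (circuitOp ρ m (fun i => stepW ρ cg m i (V i)) n).conjTranspose
        * circuitOp ρ m (fun i => stepW ρ cg m i (V i)) n = conjChoi C
  | 0, C, hC, _ => ⟨fun _ _ => 0, fun i hi => absurd hi (Nat.not_lt_zero i),
      circuitOp_zero_intertwines, circuitOp_zero_gram hm0 hC.2⟩
  | n + 1, C, hC, hCi => by
    obtain ⟨V, hV, hTi, hT⟩ := exists_circuit hρ cg hm0 hm1 hm2 n (reduce C) hC.reduce hCi.reduce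
    obtain ⟨K⟩ := CGTransform.nonempty (sysRep_continuous hρ (2 * n + 1))
    obtain ⟨K'⟩ := CGTransform.nonempty (sysRep_continuous hρ (2 * (n + 1)))
    obtain ⟨S, hS, hSi⟩ := exists_intertwiner_gram_eq K' (hm1 n) (conjChoi_posSemidef hC.1) hCi
    set T := circuitOp ρ m (fun i => stepW ρ cg m i (V i)) n with hTdef
    let X : Matrix (Aux ρ m n × Fin (d (2 * n))) (Sys d (2 * n + 1)) ℂ :=
      T ⊗ₖ (1 : Matrix (Fin (d (2 * n))) (Fin (d (2 * n))) ℂ)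
    let S' : Matrix (Aux ρ m (n + 1)) (Sys d (2 * n + 1) × Fin (d (2 * n + 1))) ℂ := S
    -- This is the comb condition: both sides equal C̄_n ⊗ 1, the left by induction and the right by
    -- tracing the last output out of S†S.
    have hgram : X.conjTranspose * X = (bend S').conjTranspose * bend S' := by
      rw [Matrix.conjTranspose_kronecker, ← Matrix.mul_kronecker_mul, hT,
        Matrix.conjTranspose_one, Matrix.one_mul]
      ext z z'
      rw [gram_bend]
      exact ((Finset.sum_congr rfl fun b _ => congrFun (congrFun hS (z, b)) (z', b)).trans
        (conjChoi_trace hC z.1 z'.1 z.2 z'.2)).symm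
    obtain ⟨Vn, hVn, hVX⟩ := exists_stepW_mul_eq cg n
      (card_vIn_le_card_vOut hm2 n hC.dim_pos K') (X := X) (S := bend S') K
      (fun a μ => (hTi a μ).tensor_one (ρ (2 * n)))
      (fun a ν => Intertwines.bend (hSi a ν)) hgram
    let V' := Function.update V n Vn
    have hlt : ∀ i < n, V' i = V i := fun i hi => Function.update_of_ne hi.ne _ _
    have hself : V' n = Vn := Function.update_self _ _ _
    have hop : circuitOp ρ m (fun i => stepW ρ cg m i (V' i)) (n + 1) = S := by
      have hT' : circuitOp ρ m (fun i => stepW ρ cg m i (V' i)) n = T :=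
        circuitOp_congr fun i hi => by rw [hlt i hi]
      refine circuitOp_succ_eq ?_
      rw [hT', hself]
      exact hVX
    refine ⟨V', fun i hi l => ?_, ?_, ?_⟩
    · rcases Nat.lt_succ_iff_lt_or_eq.1 hi with h | rfl
      · rw [hlt i h]; exact hV i h l
      · rw [hself]; exact hVn l
    · rw [hop]; exact hSi
    · rw [hop]; exact hS

/-- A comb whose conjugate Choi matrix is covariant is realized by the circuit. -/
theorem realizedByCircuit (hρ : ∀ k, Continuous fun g => (ρ k).mat g) {n : ℕ} {C : ChoiMat d n}
    (hC : IsComb n C) (hCi : ConjCovariant ρ n C) : RealizedByCircuit ρ n C := by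
  have htensor : ∀ (l : Irr G) {o : ℕ} (υ : URep G (Fin o)), (Continuous fun g => υ.mat g) →
      Continuous fun g => (l.rep.tensor υ).mat g := fun l o υ hυ =>
    continuous_matrix fun i j =>
      ((Quotient.out l).cont.matrix_elem i.1 j.1).mul (hυ.matrix_elem i.2 j.2)
  have hconj : ∀ k, Continuous fun g => (ρ k).conj.mat g := fun k =>
    continuous_matrix fun i j => Complex.continuous_conj.comp ((hρ k).matrix_elem i j)
  refine ⟨⟨⟨fun i μ => (CGTransform.nonempty (htensor μ.1 _ (hρ _))).some,
    fun i ν => (CGTransform.nonempty (htensor ν.1 _ (hconj _))).some⟩⟩, fun cg => ?_⟩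
  obtain ⟨m, hm0, hm1, hm2⟩ := exists_memory ρ
  obtain ⟨V, hV, -, hT⟩ := exists_circuit hρ cg hm0 hm1 hm2 n C hC hCi
  exact ⟨m, hm0, V, hV, fun i hi => stepW_isIsometry cg i (hV i hi), choiOf_circuit hT⟩

end Circuits

end QComb

theorem mainTheorem2 {G : Type*} [Group G] [TopologicalSpace G] [IsTopologicalGroup G]
    [CompactSpace G] {d : ℕ → ℕ} (ρ : ∀ k, QComb.URep G (Fin (d k)))
    (hρ : ∀ k, Continuous fun g => (ρ k).mat g)
    (n : ℕ) (C : QComb.ChoiMat d n) (hC : QComb.IsComb n C) :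
    (QComb.ChoiCovariant ρ n C → QComb.RealizedByCircuit (fun k => (ρ k).conj) n C) ∧
      (QComb.ChannelCovariant ρ n C → QComb.RealizedByCircuit ρ n C) :=
  ⟨fun h => QComb.realizedByCircuit
      (fun k => continuous_matrix fun i j => Complex.continuous_conj.comp ((hρ k).matrix_elem i j))
      hC h.conjCovariant,
    fun h => QComb.realizedByCircuit hρ hC h.conjCovariant⟩
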